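/- For each of the two scores $f(R)=\text{area of }R$ and $f(R)=\text{perimeter of }R$, there is a real-RAM program which, given a set $P$ of $n$ points in the plane $\mathbb{R}^2$ (listed in arbitrary order by their coordinates) and an integer $k$ with $1\le k\le n$, computes in $O(n^2\log n)$ time in the worst case an axis-aligned rectangle that encloses at least $k$ points of $P$ and has the smallest score $f$ among all axis-aligned rectangles that enclose at least $k$ points of $P$. Rectangles $[a,b]\times[c,d]$ with $a\le b$, $c\le d$ are closed and may degenerate to segments or points. The program is a single program for all $n$, $k$ and $P$, and the constant in the time bound is absolute. The real RAM performs each of the following in one step: an arithmetic operation ($+,-,\times,\div$) on or comparison of exact real numbers, an arithmetic operation on or comparison of integers of $O(\log n)$ bits, and an access to memory indexed by such integers; it has no rounding and no conversion of reals to integers. -/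

import Mathlib

open Filter Asymptotics

/-! ## The real RAM

A uniform real RAM: programs are finite pieces of syntax that do not depend on the input. The
machine has word registers and word arrays holding natural numbers below a bound `B` (words of
`log₂ B` bits), and real registers and real arrays holding exact real numbers. Registers and arrays
are named by natural numbers; a program mentions only finitely many of them. Arrays are addressed
by words. Reals can only be added, subtracted, multiplied, divided and compared: there is no
rounding and no conversion from reals to words, and the only real constants are integers.
Every primitive operation takes one step. An operation whose result does not fit into a word, and a
division by zero, have no result: a computation that attempts one gets stuck. -/

namespace RealRAM

/-- The contents of all registers and arrays. -/
structure State where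
  /-- word registers -/
  wreg : ℕ → ℕ
  /-- real registers -/
  rreg : ℕ → ℝ
  /-- word arrays: `warr a i` is entry `i` of array `a` -/
  warr : ℕ → ℕ → ℕ
  /-- real arrays: `rarr a i` is entry `i` of array `a` -/
  rarr : ℕ → ℕ → ℝ

/-- Word expressions. -/
inductive WExpr : Type
  | lit (v : ℕ)
  | reg (x : ℕ)
  | get (a : ℕ) (e : WExpr)
  | add (e f : WExpr)
  | sub (e f : WExpr)
  | mul (e f : WExpr)
  | div (e f : WExpr)
  | mod (e f : WExpr)

/-- Real expressions. -/
inductive RExpr : Type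
  | lit (z : ℤ)
  | reg (x : ℕ)
  | get (a : ℕ) (e : WExpr)
  | add (e f : RExpr)
  | sub (e f : RExpr)
  | mul (e f : RExpr)
  | div (e f : RExpr)

/-- Tests: comparisons of words and of reals, and their Boolean combinations. -/
inductive Test : Type
  | wlt (e f : WExpr)
  | weq (e f : WExpr)
  | rlt (e f : RExpr)
  | req (e f : RExpr)
  | not (b : Test)
  | and (b c : Test)
  | or (b c : Test)

/-- Programs. -/
inductive Prog : Type
  | skip
  | setW (x : ℕ) (e : WExpr)
  | setR (x : ℕ) (e : RExpr)
  | putW (a : ℕ) (i e : WExpr)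
  | putR (a : ℕ) (i : WExpr) (e : RExpr)
  | seq (p q : Prog)
  | ite (b : Test) (p q : Prog)
  | while (b : Test) (p : Prog)

/-- `v` as the result of a word operation, if it fits into a word. -/
def fit (B v : ℕ) : Option ℕ := if v < B then some v else none

/-- Value of a word expression (`sub` is truncated, `div` rounds down). -/
def WExpr.eval (B : ℕ) (s : State) : WExpr → Option ℕ
  | .lit v => fit B v
  | .reg x => some (s.wreg x)
  | .get a e => do
      let i ← e.eval B s
      some (s.warr a i)
  | .add e f => do
      let u ← e.eval B s
      let v ← f.eval B s
      fit B (u + v)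
  | .sub e f => do
      let u ← e.eval B s
      let v ← f.eval B s
      fit B (u - v)
  | .mul e f => do
      let u ← e.eval B s
      let v ← f.eval B s
      fit B (u * v)
  | .div e f => do
      let u ← e.eval B s
      let v ← f.eval B s
      if v = 0 then none else fit B (u / v)
  | .mod e f => do
      let u ← e.eval B s
      let v ← f.eval B s
      if v = 0 then none else fit B (u % v)

/-- Value of a real expression. -/
noncomputable def RExpr.eval (B : ℕ) (s : State) : RExpr → Option ℝ
  | .lit z => some (z : ℝ)
  | .reg x => some (s.rreg x)
  | .get a e => do
      let i ← e.eval B s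
      some (s.rarr a i)
  | .add e f => do
      let u ← e.eval B s
      let v ← f.eval B s
      some (u + v)
  | .sub e f => do
      let u ← e.eval B s
      let v ← f.eval B s
      some (u - v)
  | .mul e f => do
      let u ← e.eval B s
      let v ← f.eval B s
      some (u * v)
  | .div e f => do
      let u ← e.eval B s
      let v ← f.eval B s
      if v = 0 then none else some (u / v)

/-- Truth value of a test. -/
noncomputable def Test.eval (B : ℕ) (s : State) : Test → Option Bool
  | .wlt e f => do
      let u ← e.eval B s
      let v ← f.eval B s
      some (decide (u < v))
  | .weq e f => do
      let u ← e.eval B s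
      let v ← f.eval B s
      some (decide (u = v))
  | .rlt e f => do
      let u ← e.eval B s
      let v ← f.eval B s
      some (decide (u < v))
  | .req e f => do
      let u ← e.eval B s
      let v ← f.eval B s
      some (decide (u = v))
  | .not b => do
      let x ← b.eval B s
      some (!x)
  | .and b c => do
      let x ← b.eval B s
      let y ← c.eval B s
      some (x && y)
  | .or b c => do
      let x ← b.eval B s
      let y ← c.eval B s
      some (x || y)

/-- Number of steps that the evaluation of a word expression takes: one for each node. -/
def WExpr.cost : WExpr → ℕ
  | .lit _ => 1
  | .reg _ => 1
  | .get _ e => e.cost + 1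
  | .add e f => e.cost + f.cost + 1
  | .sub e f => e.cost + f.cost + 1
  | .mul e f => e.cost + f.cost + 1
  | .div e f => e.cost + f.cost + 1
  | .mod e f => e.cost + f.cost + 1

/-- Number of steps that the evaluation of a real expression takes: one for each node. -/
def RExpr.cost : RExpr → ℕ
  | .lit _ => 1
  | .reg _ => 1
  | .get _ e => e.cost + 1
  | .add e f => e.cost + f.cost + 1
  | .sub e f => e.cost + f.cost + 1
  | .mul e f => e.cost + f.cost + 1
  | .div e f => e.cost + f.cost + 1

/-- Number of steps that the evaluation of a test takes: one for each node. -/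
def Test.cost : Test → ℕ
  | .wlt e f => e.cost + f.cost + 1
  | .weq e f => e.cost + f.cost + 1
  | .rlt e f => e.cost + f.cost + 1
  | .req e f => e.cost + f.cost + 1
  | .not b => b.cost + 1
  | .and b c => b.cost + c.cost + 1
  | .or b c => b.cost + c.cost + 1

/-- `Exec B p s t s'`: with words bounded by `B`, the program `p` started in state `s` halts after
exactly `t` steps, in state `s'`. -/
inductive Exec (B : ℕ) : Prog → State → ℕ → State → Prop
  | skip (s : State) : Exec B .skip s 1 s
  | setW (s : State) (x : ℕ) (e : WExpr) (v : ℕ) (he : e.eval B s = some v) :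
      Exec B (.setW x e) s (e.cost + 1) { s with wreg := Function.update s.wreg x v }
  | setR (s : State) (x : ℕ) (e : RExpr) (v : ℝ) (he : e.eval B s = some v) :
      Exec B (.setR x e) s (e.cost + 1) { s with rreg := Function.update s.rreg x v }
  | putW (s : State) (a : ℕ) (i e : WExpr) (j v : ℕ)
      (hi : i.eval B s = some j) (he : e.eval B s = some v) :
      Exec B (.putW a i e) s (i.cost + e.cost + 1)
        { s with warr := Function.update s.warr a (Function.update (s.warr a) j v) }
  | putR (s : State) (a : ℕ) (i : WExpr) (e : RExpr) (j : ℕ) (v : ℝ)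
      (hi : i.eval B s = some j) (he : e.eval B s = some v) :
      Exec B (.putR a i e) s (i.cost + e.cost + 1)
        { s with rarr := Function.update s.rarr a (Function.update (s.rarr a) j v) }
  | seq {p q : Prog} {s s₁ s₂ : State} {t₁ t₂ : ℕ}
      (hp : Exec B p s t₁ s₁) (hq : Exec B q s₁ t₂ s₂) :
      Exec B (.seq p q) s (t₁ + t₂) s₂
  | ite_true {b : Test} {p q : Prog} {s s' : State} {t : ℕ}
      (hb : b.eval B s = some true) (hp : Exec B p s t s') :
      Exec B (.ite b p q) s (b.cost + 1 + t) s'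
  | ite_false {b : Test} {p q : Prog} {s s' : State} {t : ℕ}
      (hb : b.eval B s = some false) (hq : Exec B q s t s') :
      Exec B (.ite b p q) s (b.cost + 1 + t) s'
  | while_false {b : Test} {p : Prog} {s : State} (hb : b.eval B s = some false) :
      Exec B (.while b p) s (b.cost + 1) s
  | while_true {b : Test} {p : Prog} {s s₁ s₂ : State} {t₁ t₂ : ℕ}
      (hb : b.eval B s = some true) (hp : Exec B p s t₁ s₁)
      (hw : Exec B (.while b p) s₁ t₂ s₂) :
      Exec B (.while b p) s (b.cost + 1 + t₁ + t₂) s₂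

end RealRAM

/-! ## Rectangles -/

/-- A closed axis-aligned rectangle `[left, right] × [bottom, top]` in the plane, possibly
degenerate to a segment or a point. -/
structure Rect where
  left : ℝ
  right : ℝ
  bottom : ℝ
  top : ℝ
  left_le_right : left ≤ right
  bottom_le_top : bottom ≤ top

namespace Rect

/-- The points of a rectangle. -/
def toSet (R : Rect) : Set (ℝ × ℝ) := Set.Icc R.left R.right ×ˢ Set.Icc R.bottom R.top

def area (R : Rect) : ℝ := (R.right - R.left) * (R.top - R.bottom)

def perimeter (R : Rect) : ℝ := 2 * ((R.right - R.left) + (R.top - R.bottom))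

/-- `R` encloses (at least) `k` points of `P`. -/
def Encloses (R : Rect) (P : Set (ℝ × ℝ)) (k : ℕ) : Prop :=
  ∃ Q : Finset (ℝ × ℝ), (Q : Set (ℝ × ℝ)) ⊆ P ∩ R.toSet ∧ Q.card = k

/-- `R` has the smallest score among the rectangles that enclose `k` points of `P`. -/
def IsSmallest (score : Rect → ℝ) (P : Set (ℝ × ℝ)) (k : ℕ) (R : Rect) : Prop :=
  R.Encloses P k ∧ ∀ R' : Rect, R'.Encloses P k → score R ≤ score R'

end Rect

/-! ## Input and output -/

/-- The initial state for the points `p 0, …, p (n - 1)` and the number `k`: word registers `0` and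
`1` hold `n` and `k`, real arrays `0` and `1` hold the `x`- and the `y`-coordinates of the points,
everything else is zero. -/
noncomputable def inputState {n : ℕ} (p : Fin n → ℝ × ℝ) (k : ℕ) : RealRAM.State where
  wreg := fun x => if x = 0 then n else if x = 1 then k else 0
  rreg := fun _ => 0
  warr := fun _ _ => 0
  rarr := fun a i =>
    if h : i < n then
      if a = 0 then (p ⟨i, h⟩).1 else if a = 1 then (p ⟨i, h⟩).2 else 0
    else 0

/-- The real registers `0, 1, 2, 3` of the state `s` hold the left, right, bottom and top
coordinates of `R`. -/
def OutputsRect (s : RealRAM.State) (R : Rect) : Prop :=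
  s.rreg 0 = R.left ∧ s.rreg 1 = R.right ∧ s.rreg 2 = R.bottom ∧ s.rreg 3 = R.top

/-!
# Smallest `k`-enclosing rectangles on the real RAM in `O(n² log n)` steps

Replace the coordinates by ranks (ties broken by the index), so that each of the rows `0, …, n - 1`
contains one point. It suffices to find, for every range of rows `[y₁, y₂]`, a narrowest interval
of `x`-ranks that contains exactly `k` points of these rows: a smallest rectangle is among the
rectangles obtained (`exists_interval_of_encloses`), since area and perimeter are monotone in width
and height.

This is done by divide and conquer on the pair `(y₁, y₂)`. On level `g`, the rows are divided into
blocks of `m = 2 ^ (H - g)` rows, and each pair of blocks `(a, b)` has a list of candidate intervals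
that serves all `y₁` in `a` and all `y₂` in `b`. The lists are kept short by the following
observation (`cnt_eq_of_mark_eq`). Consider the slab of all rows from block `a` to block `b`, and
among intervals with the same number of points in the slab the pairs `(u, v)`, where `u` points of
the blocks `a` and `b` lie to the left of the left end and `v` to the left of the right end. These
pairs form a chain, so that `u + v` determines both of them, and then also the number of points in
each range of rows from `a` to `b`. Hence a narrowest candidate for each value of `u + v ≤ 4 m`
and each number of points in the slab, which may be restricted to `[k, k + 2 m]`, is enough. This
makes `O(m²)` candidates for each of the `(n / m)²` pairs of blocks, `O(n²)` for each level, and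
`O(n² log n)` in total. The position of a candidate in the table (`key`) is computed in constant
time from prefix counts of the points.

The program fills the top level with all intervals, and then goes through the table once. A
candidate at an inner level is passed on to the four pairs of halves of its blocks, and one at the
last level, where blocks are single rows, is compared with the best rectangle so far.
`exists_entry` shows that this finds a narrowest interval for every range of rows.

Programs are verified with weakest preconditions for code without loops (`Runs.of_wp`) and
invariants indexed by the number of rounds for loops (`Runs.while`, `Runs.for`); both bound the
number of steps along with the result.
-/

/-! ### Program verification on the real RAM -/

namespace RealRAM

/-- The value of a word expression when no operation overflows. -/
def WExpr.val (s : State) : WExpr → ℕ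
  | .lit v => v
  | .reg x => s.wreg x
  | .get a e => s.warr a (e.val s)
  | .add e f => e.val s + f.val s
  | .sub e f => e.val s - f.val s
  | .mul e f => e.val s * f.val s
  | .div e f => e.val s / f.val s
  | .mod e f => e.val s % f.val s

/-- No operation in the word expression overflows or divides by zero. -/
def WExpr.Ok (B : ℕ) (s : State) : WExpr → Prop
  | .lit v => v < B
  | .reg _ => True
  | .get _ e => e.Ok B s
  | .add e f => e.Ok B s ∧ f.Ok B s ∧ e.val s + f.val s < B
  | .sub e f => e.Ok B s ∧ f.Ok B s ∧ e.val s - f.val s < B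
  | .mul e f => e.Ok B s ∧ f.Ok B s ∧ e.val s * f.val s < B
  | .div e f => e.Ok B s ∧ f.Ok B s ∧ f.val s ≠ 0 ∧ e.val s / f.val s < B
  | .mod e f => e.Ok B s ∧ f.Ok B s ∧ f.val s ≠ 0 ∧ e.val s % f.val s < B

theorem WExpr.eval_eq_some {B : ℕ} {s : State} {e : WExpr} (h : e.Ok B s) :
    e.eval B s = some (e.val s) := by
  induction e with
  | lit v => simpa [WExpr.eval, WExpr.val, WExpr.Ok, fit] using h
  | reg x => rfl
  | get a e ih => simp [WExpr.eval, WExpr.val, ih h]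
  | add e f ihe ihf | sub e f ihe ihf | mul e f ihe ihf =>
    obtain ⟨h1, h2, h3⟩ := h
    simp [WExpr.eval, WExpr.val, ihe h1, ihf h2, fit, h3]
  | div e f ihe ihf | mod e f ihe ihf =>
    obtain ⟨h1, h2, h3, h4⟩ := h
    simp [WExpr.eval, WExpr.val, ihe h1, ihf h2, fit, h3, h4]

/-- The value of a real expression when no word operation overflows. -/
noncomputable def RExpr.val (s : State) : RExpr → ℝ
  | .lit z => (z : ℝ)
  | .reg x => s.rreg x
  | .get a e => s.rarr a (e.val s)
  | .add e f => e.val s + f.val s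
  | .sub e f => e.val s - f.val s
  | .mul e f => e.val s * f.val s
  | .div e f => e.val s / f.val s

/-- No word operation in the real expression overflows and no division in it is by zero. -/
def RExpr.Ok (B : ℕ) (s : State) : RExpr → Prop
  | .lit _ => True
  | .reg _ => True
  | .get _ e => e.Ok B s
  | .add e f => e.Ok B s ∧ f.Ok B s
  | .sub e f => e.Ok B s ∧ f.Ok B s
  | .mul e f => e.Ok B s ∧ f.Ok B s
  | .div e f => e.Ok B s ∧ f.Ok B s ∧ f.val s ≠ 0

theorem RExpr.eval_eq_some {B : ℕ} {s : State} {e : RExpr} (h : e.Ok B s) :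
    e.eval B s = some (e.val s) := by
  induction e with
  | lit v => rfl
  | reg x => rfl
  | get a e => simp [RExpr.eval, RExpr.val, WExpr.eval_eq_some h]
  | add e f ihe ihf | sub e f ihe ihf | mul e f ihe ihf =>
    simp [RExpr.eval, RExpr.val, ihe h.1, ihf h.2]
  | div e f ihe ihf =>
    obtain ⟨h1, h2, h3⟩ := h
    simp [RExpr.eval, RExpr.val, ihe h1, ihf h2, h3]

/-- The proposition that a test decides. -/
def Test.Holds (s : State) : Test → Prop
  | .wlt e f => e.val s < f.val s
  | .weq e f => e.val s = f.val s
  | .rlt e f => e.val s < f.val s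
  | .req e f => e.val s = f.val s
  | .not b => ¬ b.Holds s
  | .and b c => b.Holds s ∧ c.Holds s
  | .or b c => b.Holds s ∨ c.Holds s

/-- The expressions compared in a test have values. -/
def Test.Ok (B : ℕ) (s : State) : Test → Prop
  | .wlt e f => e.Ok B s ∧ f.Ok B s
  | .weq e f => e.Ok B s ∧ f.Ok B s
  | .rlt e f => e.Ok B s ∧ f.Ok B s
  | .req e f => e.Ok B s ∧ f.Ok B s
  | .not b => b.Ok B s
  | .and b c => b.Ok B s ∧ c.Ok B s
  | .or b c => b.Ok B s ∧ c.Ok B s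

theorem Test.eval_eq {B : ℕ} {s : State} {b : Test} (h : b.Ok B s) :
    (b.Holds s → b.eval B s = some true) ∧ (¬ b.Holds s → b.eval B s = some false) := by
  induction b with
  | wlt e f | weq e f =>
    simp [Test.eval, Test.Holds, WExpr.eval_eq_some h.1, WExpr.eval_eq_some h.2]
  | rlt e f | req e f =>
    simp [Test.eval, Test.Holds, RExpr.eval_eq_some h.1, RExpr.eval_eq_some h.2]
  | not b ih =>
    obtain ⟨h1, h2⟩ := ih h
    by_cases hb : b.Holds s <;> simp_all [Test.eval, Test.Holds]
  | and b c ihb ihc | or b c ihb ihc =>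
    obtain ⟨h1, h2⟩ := ihb h.1
    obtain ⟨h3, h4⟩ := ihc h.2
    by_cases hb : b.Holds s <;> by_cases hc : c.Holds s <;> simp_all [Test.eval, Test.Holds]

theorem Test.eval_true {B : ℕ} {s : State} {b : Test} (h : b.Ok B s) (hb : b.Holds s) :
    b.eval B s = some true := (Test.eval_eq h).1 hb

theorem Test.eval_false {B : ℕ} {s : State} {b : Test} (h : b.Ok B s) (hb : ¬ b.Holds s) :
    b.eval B s = some false := (Test.eval_eq h).2 hb

/-- `Runs B p s T Q`: started in state `s`, the program `p` halts after at most `T` steps, in a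
state that satisfies `Q`. -/
def Runs (B : ℕ) (p : Prog) (s : State) (T : ℕ) (Q : State → Prop) : Prop :=
  ∃ t s', Exec B p s t s' ∧ t ≤ T ∧ Q s'

theorem Runs.mono {B : ℕ} {p : Prog} {s : State} {T T' : ℕ} {Q Q' : State → Prop}
    (h : Runs B p s T Q) (hT : T ≤ T') (hQ : ∀ s', Q s' → Q' s') : Runs B p s T' Q' := by
  obtain ⟨t, s', h1, h2, h3⟩ := h
  exact ⟨t, s', h1, h2.trans hT, hQ s' h3⟩

theorem Runs.seq {B : ℕ} {p q : Prog} {s : State} {T T' : ℕ} {Q R : State → Prop}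
    (hp : Runs B p s T R) (hq : ∀ s', R s' → Runs B q s' T' Q) :
    Runs B (.seq p q) s (T + T') Q := by
  obtain ⟨t, s', h1, h2, h3⟩ := hp
  obtain ⟨t', s'', h1', h2', h3'⟩ := hq s' h3
  exact ⟨_, s'', .seq h1 h1', add_le_add h2 h2', h3'⟩

theorem Runs.ite {B : ℕ} {b : Test} {p q : Prog} {s : State} {T T' : ℕ} {Q : State → Prop}
    (hb : b.Ok B s) (hp : b.Holds s → Runs B p s T Q) (hq : ¬ b.Holds s → Runs B q s T' Q) :
    Runs B (.ite b p q) s (b.cost + 1 + (T + T')) Q := by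
  by_cases h : b.Holds s
  · obtain ⟨t, s', h1, h2, h3⟩ := hp h
    exact ⟨_, s', .ite_true (Test.eval_true hb h) h1, by omega, h3⟩
  · obtain ⟨t, s', h1, h2, h3⟩ := hq h
    exact ⟨_, s', .ite_false (Test.eval_false hb h) h1, by omega, h3⟩

/-- A loop whose body is executed exactly `c` times, with an invariant indexed by the number of
rounds done. -/
theorem Runs.while {B : ℕ} {b : Test} {p : Prog} {T c : ℕ} {I : ℕ → State → Prop}
    (hstep : ∀ i < c, ∀ s, I i s → b.Ok B s ∧ b.Holds s ∧ Runs B p s T (I (i + 1)))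
    (hend : ∀ s, I c s → b.Ok B s ∧ ¬ b.Holds s) {s : State} (h0 : I 0 s) :
    Runs B (.while b p) s (c * (b.cost + 1 + T) + (b.cost + 1)) (I c) := by
  suffices H : ∀ d i, i + d = c → ∀ s, I i s →
      Runs B (.while b p) s (d * (b.cost + 1 + T) + (b.cost + 1)) (I c) from
    H c 0 (by omega) s h0
  intro d
  induction d with
  | zero =>
    intro i hi s hs
    obtain rfl : i = c := by omega
    obtain ⟨h1, h2⟩ := hend s hs
    exact ⟨_, s, .while_false (Test.eval_false h1 h2), by omega, hs⟩
  | succ d ih =>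
    intro i hi s hs
    obtain ⟨h1, h2, t, s', h3, h4, h5⟩ := hstep i (by omega) s hs
    obtain ⟨t', s'', h6, h7, h8⟩ := ih (i + 1) (by omega) s' h5
    exact ⟨_, s'', .while_true (Test.eval_true h1 h2) h3 h6, by rw [Nat.succ_mul]; omega, h8⟩

/-- The state after the assignment of `v` to the word register `x`. -/
def State.setW (s : State) (x v : ℕ) : State :=
  { s with wreg := Function.update s.wreg x v }

/-- The state after the assignment of `v` to the real register `x`. -/
noncomputable def State.setR (s : State) (x : ℕ) (v : ℝ) : State :=
  { s with rreg := Function.update s.rreg x v }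

/-- The state after storing `v` at position `j` of the word array `a`. -/
def State.putW (s : State) (a j v : ℕ) : State :=
  { s with warr := Function.update s.warr a (Function.update (s.warr a) j v) }

/-- The state after storing `v` at position `j` of the real array `a`. -/
noncomputable def State.putR (s : State) (a j : ℕ) (v : ℝ) : State :=
  { s with rarr := Function.update s.rarr a (Function.update (s.rarr a) j v) }

section StateSimp
variable (s : State) (x y a b i j v : ℕ) (w : ℝ)

@[simp] theorem State.setW_wreg : (s.setW x v).wreg y = if y = x then v else s.wreg y := by
  simp [State.setW, Function.update_apply]
@[simp] theorem State.setW_rreg : (s.setW x v).rreg = s.rreg := rfl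
@[simp] theorem State.setW_warr : (s.setW x v).warr = s.warr := rfl
@[simp] theorem State.setW_rarr : (s.setW x v).rarr = s.rarr := rfl
@[simp] theorem State.setR_wreg : (s.setR x w).wreg = s.wreg := rfl
@[simp] theorem State.setR_rreg : (s.setR x w).rreg y = if y = x then w else s.rreg y := by
  simp [State.setR, Function.update_apply]
@[simp] theorem State.setR_warr : (s.setR x w).warr = s.warr := rfl
@[simp] theorem State.setR_rarr : (s.setR x w).rarr = s.rarr := rfl
@[simp] theorem State.putW_wreg : (s.putW a j v).wreg = s.wreg := rfl
@[simp] theorem State.putW_rreg : (s.putW a j v).rreg = s.rreg := rfl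
@[simp] theorem State.putW_warr :
    (s.putW a j v).warr b = if b = a then Function.update (s.warr a) j v else s.warr b := by
  simp [State.putW, Function.update_apply]
@[simp] theorem State.putW_rarr : (s.putW a j v).rarr = s.rarr := rfl
@[simp] theorem State.putR_wreg : (s.putR a j w).wreg = s.wreg := rfl
@[simp] theorem State.putR_rreg : (s.putR a j w).rreg = s.rreg := rfl
@[simp] theorem State.putR_warr : (s.putR a j w).warr = s.warr := rfl
@[simp] theorem State.putR_rarr :
    (s.putR a j w).rarr b = if b = a then Function.update (s.rarr a) j w else s.rarr b := by
  simp [State.putR, Function.update_apply]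

end StateSimp

/-- Weakest precondition of a program without loops. -/
def Prog.wp (B : ℕ) : Prog → (State → Prop) → State → Prop
  | .skip, Q, s => Q s
  | .setW x e, Q, s => e.Ok B s ∧ Q (s.setW x (e.val s))
  | .setR x e, Q, s => e.Ok B s ∧ Q (s.setR x (e.val s))
  | .putW a i e, Q, s => (i.Ok B s ∧ e.Ok B s) ∧ Q (s.putW a (i.val s) (e.val s))
  | .putR a i e, Q, s => (i.Ok B s ∧ e.Ok B s) ∧ Q (s.putR a (i.val s) (e.val s))
  | .seq p q, Q, s => p.wp B (q.wp B Q) s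
  | .ite b p q, Q, s => b.Ok B s ∧ (b.Holds s → p.wp B Q s) ∧ (¬ b.Holds s → q.wp B Q s)
  | .while _ _, _, _ => False

/-- An upper bound for the number of steps of a program without loops. -/
def Prog.bound : Prog → ℕ
  | .skip => 1
  | .setW _ e => e.cost + 1
  | .setR _ e => e.cost + 1
  | .putW _ i e => i.cost + e.cost + 1
  | .putR _ i e => i.cost + e.cost + 1
  | .seq p q => p.bound + q.bound
  | .ite b p q => b.cost + 1 + (p.bound + q.bound)
  | .while _ _ => 0

theorem Runs.of_wp {B : ℕ} {p : Prog} {Q : State → Prop} {s : State} (h : p.wp B Q s) :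
    Runs B p s p.bound Q := by
  induction p generalizing Q s with
  | skip => exact ⟨_, _, .skip s, le_rfl, h⟩
  | setW x e => exact ⟨_, _, .setW s x e _ (WExpr.eval_eq_some h.1), le_rfl, h.2⟩
  | setR x e => exact ⟨_, _, .setR s x e _ (RExpr.eval_eq_some h.1), le_rfl, h.2⟩
  | putW a i e =>
    exact ⟨_, _, .putW s a i e _ _ (WExpr.eval_eq_some h.1.1) (WExpr.eval_eq_some h.1.2), le_rfl,
      h.2⟩
  | putR a i e =>
    exact ⟨_, _, .putR s a i e _ _ (WExpr.eval_eq_some h.1.1) (RExpr.eval_eq_some h.1.2), le_rfl,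
      h.2⟩
  | seq p q ihp ihq => exact (ihp h).seq fun s' hs' => ihq hs'
  | ite b p q ihp ihq => exact .ite h.1 (fun hb => ihp (h.2.1 hb)) (fun hb => ihq (h.2.2 hb))
  | _ => exact h.elim

/-- The loop `for x = 0, …, e - 1 do p`. -/
def Prog.for (x : ℕ) (e : WExpr) (p : Prog) : Prog :=
  .seq (.setW x (.lit 0))
    (.while (.wlt (.reg x) e) (.seq p (.setW x (.add (.reg x) (.lit 1)))))

/-- A bound for the number of steps of `for x = 0, …, c - 1 do p` if `p` takes at most `T` steps. -/
def forTime (e : WExpr) (c T : ℕ) : ℕ := (c + 1) * (T + e.cost + 8)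

/-- Rule for `for` loops: the invariant is indexed by the value of the loop register. -/
theorem Runs.for {B x c T : ℕ} {e : WExpr} {p : Prog} {I : ℕ → State → Prop}
    (hB : 1 < B) (hcB : c < B)
    (hI : ∀ i s, I i s → e.Ok B s ∧ e.val s = c)
    (hx : ∀ i s v, I i s → I i (s.setW x v))
    (hstep : ∀ i < c, ∀ s, I i s → s.wreg x = i →
      Runs B p s T (fun s' => s'.wreg x = i ∧ I (i + 1) s'))
    {s : State} (h0 : I 0 s) :
    Runs B (.for x e p) s (forTime e c T) (I c) := by
  have hw := Runs.while (B := B) (b := .wlt (.reg x) e)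
    (p := .seq p (.setW x (.add (.reg x) (.lit 1)))) (T := T + 4) (c := c)
    (I := fun i s => s.wreg x = i ∧ I i s) ?_ ?_ (s := s.setW x 0) ⟨by simp, hx _ _ _ h0⟩
  · refine Runs.mono (Runs.seq (T := 2) (R := fun s' => s' = s.setW x 0)
      (Runs.of_wp (p := .setW x (.lit 0)) (B := B) ?_) (fun s' hs' => hs' ▸ hw)) ?_ ?_
    · exact ⟨Nat.lt_of_succ_lt hB, rfl⟩
    · simp only [Test.cost, WExpr.cost, forTime]
      ring_nf; omega
    · exact fun s' hs' => hs'.2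
  · rintro i hi s ⟨hsx, hs⟩
    obtain ⟨h1, h2⟩ := hI i s hs
    refine ⟨⟨trivial, h1⟩, ?_, ?_⟩
    · simpa [Test.Holds, WExpr.val, hsx, h2] using hi
    · refine (hstep i hi s hs hsx).seq fun s' hs' => Runs.of_wp
        (p := .setW x (.add (.reg x) (.lit 1))) (B := B) ?_
      have h3 : s'.wreg x + 1 < B := by rw [hs'.1]; omega
      refine ⟨⟨trivial, hB, h3⟩, ?_, hx _ _ _ hs'.2⟩
      simp [WExpr.val, hs'.1]
  · rintro s ⟨hsx, hs⟩
    obtain ⟨h1, h2⟩ := hI c s hs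
    refine ⟨⟨trivial, h1⟩, ?_⟩
    simp [Test.Holds, WExpr.val, hsx, h2]

end RealRAM

/-! ### Candidate intervals and their table -/

namespace EnclosingRect

/-- The number of rows `y ∈ [y₁, y₂)` with `π y < x`. -/
def below (π : ℕ → ℕ) (y₁ y₂ x : ℕ) : ℕ := ((Finset.Ico y₁ y₂).filter fun y => π y < x).card

/-- The number of rows `y ∈ [y₁, y₂)` with `π y ∈ [l, r)`. -/
def cnt (π : ℕ → ℕ) (y₁ y₂ l r : ℕ) : ℕ :=
  ((Finset.Ico y₁ y₂).filter fun y => l ≤ π y ∧ π y < r).card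

section Counting
variable (π : ℕ → ℕ)

theorem below_mono (y₁ y₂ : ℕ) {x x' : ℕ} (h : x ≤ x') : below π y₁ y₂ x ≤ below π y₁ y₂ x' :=
  Finset.card_le_card (Finset.monotone_filter_right _ fun _ _ hy => lt_of_lt_of_le hy h)

theorem below_add {y₁ y₂ y₃ : ℕ} (h₁ : y₁ ≤ y₂) (h₂ : y₂ ≤ y₃) (x : ℕ) :
    below π y₁ y₂ x + below π y₂ y₃ x = below π y₁ y₃ x := by
  rw [below, below, below, ← Finset.Ico_union_Ico_eq_Ico h₁ h₂, Finset.filter_union,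
    Finset.card_union_of_disjoint]
  exact Finset.disjoint_filter_filter (Finset.Ico_disjoint_Ico_consecutive _ _ _)

theorem below_le (y₁ y₂ x : ℕ) : below π y₁ y₂ x ≤ y₂ - y₁ :=
  (Finset.card_filter_le _ _).trans (by simp)

theorem below_succ (y x : ℕ) :
    below π 0 (y + 1) x = below π 0 y x + if π y < x then 1 else 0 := by
  rw [← below_add π (Nat.zero_le y) (Nat.le_succ y)]
  congr 1
  simp only [below, Nat.Ico_succ_singleton, Finset.filter_singleton]
  split_ifs <;> simp

theorem below_sub_below (y₁ y₂ x : ℕ) : below π 0 y₂ x - below π 0 y₁ x = below π y₁ y₂ x := by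
  rcases le_total y₁ y₂ with h | h
  · have := below_add π (Nat.zero_le y₁) h x
    omega
  · have := below_add π (Nat.zero_le y₂) h x
    have := below_le π y₁ y₂ x
    omega

theorem cnt_add_below (y₁ y₂ : ℕ) {l r : ℕ} (h : l ≤ r) :
    cnt π y₁ y₂ l r + below π y₁ y₂ l = below π y₁ y₂ r := by
  rw [cnt, below, below, ← Finset.card_union_of_disjoint]
  · congr 1
    ext y
    simp only [Finset.mem_union, Finset.mem_filter]
    constructor
    · rintro (⟨h1, h2⟩ | ⟨h1, h2⟩)
      · exact ⟨h1, h2.2⟩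
      · exact ⟨h1, h2.trans_le h⟩
    · rintro ⟨h1, h2⟩
      rcases lt_or_ge (π y) l with h3 | h3
      · exact .inr ⟨h1, h3⟩
      · exact .inl ⟨h1, h3, h2⟩
  · rw [Finset.disjoint_filter]
    intro y _ h1 h2
    omega

theorem cnt_eq_zero (y₁ y₂ : ℕ) {l r : ℕ} (h : r ≤ l) : cnt π y₁ y₂ l r = 0 := by
  rw [cnt, Finset.card_eq_zero, Finset.filter_eq_empty_iff]
  intro y _ h1
  omega

theorem below_sub_below_eq_cnt (y₁ y₂ l r : ℕ) :
    below π y₁ y₂ r - below π y₁ y₂ l = cnt π y₁ y₂ l r := by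
  rcases le_total l r with h | h
  · have := cnt_add_below π y₁ y₂ h
    omega
  · have := below_mono π y₁ y₂ h
    have := cnt_eq_zero π y₁ y₂ h
    omega

end Counting

/-- The number of rows in the blocks `a` and `b` of `m` rows each whose point lies to the left of
`l`, plus the number of those whose point lies to the left of `r`. Rows of a single block `a = b`
are counted twice, which does no harm. -/
def mark (π : ℕ → ℕ) (m a b l r : ℕ) : ℕ :=
  below π (a * m) (a * m + m) l + below π (b * m) (b * m + m) l +
    below π (a * m) (a * m + m) r + below π (b * m) (b * m + m) r

/-- The number of points in the rows from block `a` to block `b` (blocks of `m` rows) with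
`x`-rank in `[l, r)`. -/
def slab (π : ℕ → ℕ) (m a b l r : ℕ) : ℕ := cnt π (a * m) (b * m + m) l r

theorem mark_le (π : ℕ → ℕ) (m a b l r : ℕ) : mark π m a b l r ≤ 4 * m := by
  have h1 := below_le π (a * m) (a * m + m) l
  have h2 := below_le π (b * m) (b * m + m) l
  have h3 := below_le π (a * m) (a * m + m) r
  have h4 := below_le π (b * m) (b * m + m) r
  simp only [mark]
  omega

theorem lt_of_cnt_pos {π : ℕ → ℕ} {y₁ y₂ l r : ℕ} (h : 0 < cnt π y₁ y₂ l r) : l < r := by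
  by_contra! h'
  have := cnt_eq_zero π y₁ y₂ h'
  omega

theorem row_lt_of_cnt_pos {π : ℕ → ℕ} {y₁ y₂ l r : ℕ} (h : 0 < cnt π y₁ y₂ l r) : y₁ < y₂ := by
  by_contra! h'
  simp [cnt, Finset.Ico_eq_empty_of_le h'] at h

/-- For a fixed number of points in the slab, the pairs (marked points left of `l`, marked points
left of `r`) form a chain, so their sum determines them. Hence two intervals with the same `slab`
and `mark` contain the same number of points in every range of rows that begins in block `a` and
ends in block `b`. -/
theorem cnt_eq_of_mark_eq {π : ℕ → ℕ} {m a b l r l' r' y₁ y₂ : ℕ} (hl : l ≤ r) (hl' : l' ≤ r')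
    (hs : slab π m a b l r = slab π m a b l' r') (hm : mark π m a b l r = mark π m a b l' r')
    (hy₁ : a * m ≤ y₁) (hy₁' : y₁ ≤ a * m + m) (hy₂ : b * m ≤ y₂) (hy₂' : y₂ ≤ b * m + m)
    (hy : y₁ ≤ y₂) (hab : a ≤ b) : cnt π y₁ y₂ l r = cnt π y₁ y₂ l' r' := by
  -- everything below is linear arithmetic with `below`, which is additive in the rows and monotone
  -- in the `x`-rank
  wlog hll : l ≤ l' generalizing l r l' r'
  · exact (this hl' hl hs.symm hm.symm (by omega)).symm
  have hab' : a * m ≤ b * m := Nat.mul_le_mul_right m hab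
  have mono := fun y z => below_mono π y z hll
  have A := fun x => below_add π hy₁ hy₁' x
  have A' := fun x => below_add π (show a * m ≤ a * m + m by omega)
    (show a * m + m ≤ b * m + m by omega) x
  have Bd := fun x => below_add π hy₂ hy₂' x
  have Bd' := fun x => below_add π hab' (show b * m ≤ b * m + m by omega) x
  have S := fun x => below_add π (hy₁.trans hy) hy₂' x
  have S' := fun x => below_add π hy₁ hy x
  have c1 := cnt_add_below π (a * m) (b * m + m) hl
  have c2 := cnt_add_below π (a * m) (b * m + m) hl'
  have d1 := cnt_add_below π y₁ y₂ hl
  have d2 := cnt_add_below π y₁ y₂ hl'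
  simp only [slab, mark] at hs hm
  have key : below π (a * m) (a * m + m) l = below π (a * m) (a * m + m) l' ∧
      below π (b * m) (b * m + m) l = below π (b * m) (b * m + m) l' ∧
      below π (a * m) (a * m + m) r = below π (a * m) (a * m + m) r' ∧
      below π (b * m) (b * m + m) r = below π (b * m) (b * m + m) r' := by
    have m1 := mono (a * m) (a * m + m)
    have m2 := mono (b * m) (b * m + m)
    rcases le_total r r' with hr | hr
    · have m3 := below_mono π (a * m) (a * m + m) hr
      have m4 := below_mono π (b * m) (b * m + m) hr
      omega
    -- `r' ≤ r`: equal counts force the slab to have no point in `[l, l')` and in `[r', r)`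
    · have m3 := mono (a * m) (b * m + m)
      have m4 := below_mono π (a * m) (b * m + m) hr
      have e1 := A' r
      have e2 := A' r'
      have e3 := Bd' r
      have e4 := Bd' r'
      have m5 := below_mono π (a * m) (a * m + m) hr
      have m6 := below_mono π (a * m + m) (b * m + m) hr
      have m7 := below_mono π (a * m) (b * m) hr
      have m8 := below_mono π (b * m) (b * m + m) hr
      omega
  obtain ⟨k1, k2, k3, k4⟩ := key
  have pieces : ∀ x x', x ≤ x' →
      below π (a * m) (a * m + m) x = below π (a * m) (a * m + m) x' →
      below π (b * m) (b * m + m) x = below π (b * m) (b * m + m) x' →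
      below π (a * m) y₁ x = below π (a * m) y₁ x' ∧
      below π y₂ (b * m + m) x = below π y₂ (b * m + m) x' := by
    intro x x' hx h1 h2
    have e1 := A x
    have e2 := A x'
    have e3 := Bd x
    have e4 := Bd x'
    have m1 := below_mono π (a * m) y₁ hx
    have m2 := below_mono π y₁ (a * m + m) hx
    have m3 := below_mono π (b * m) y₂ hx
    have m4 := below_mono π y₂ (b * m + m) hx
    omega
  have p1 := pieces l l' hll k1 k2
  have p2 : below π (a * m) y₁ r = below π (a * m) y₁ r' ∧
      below π y₂ (b * m + m) r = below π y₂ (b * m + m) r' := by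
    rcases le_total r r' with hr | hr
    · exact pieces r r' hr k3 k4
    · have := pieces r' r hr k3.symm k4.symm
      exact ⟨this.1.symm, this.2.symm⟩
  have s1 := S l
  have s2 := S l'
  have s3 := S r
  have s4 := S r'
  have t1 := S' l
  have t2 := S' l'
  have t3 := S' r
  have t4 := S' r'
  omega

/-- The interval `[l, r)` contains enough points of the slab, but not so many that more than `k`
would remain whichever of the at most `2 * m` points in the blocks `a` and `b` are removed. Only such
intervals can have exactly `k` points in some range of rows from block `a` to block `b`. -/
def Valid (π : ℕ → ℕ) (k m a b l r : ℕ) : Prop :=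
  k ≤ slab π m a b l r ∧ slab π m a b l r ≤ k + 2 * m

/-- The table position of the interval `[l, r)` in the slab from block `a` to block `b` on level
`g`, where blocks have `m = 2 ^ (H - g)` rows: the number with the digits `g`, `8 * m * a + mark`,
`8 * m * b + (slab - k)` to the base `8 * 2 ^ H`. There are `2 ^ g` blocks, and `mark` and
`slab - k` are at most `4 * m` and `2 * m`, so every level has `O(4 ^ H)` positions. -/
def key (π : ℕ → ℕ) (k H g a b l r : ℕ) : ℕ :=
  (g * (8 * 2 ^ H) + (a * (8 * 2 ^ (H - g)) + mark π (2 ^ (H - g)) a b l r)) * (8 * 2 ^ H) +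
    (b * (8 * 2 ^ (H - g)) + (slab π (2 ^ (H - g)) a b l r - k))

section Key
variable {π : ℕ → ℕ} {k H g a b l r : ℕ}

theorem two_pow_mul_block (hg : g ≤ H) : 2 ^ g * 2 ^ (H - g) = 2 ^ H := by
  rw [← pow_add]
  congr 1
  omega

theorem block_mul_add_le (hg : g ≤ H) (ha : a < 2 ^ g) :
    a * 2 ^ (H - g) + 2 ^ (H - g) ≤ 2 ^ H := by
  rw [← two_pow_mul_block hg, ← Nat.succ_mul]
  exact Nat.mul_le_mul_right _ ha

theorem first_lt (hg : g ≤ H) (ha : a < 2 ^ g) :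
    a * (8 * 2 ^ (H - g)) + mark π (2 ^ (H - g)) a b l r < 8 * 2 ^ H := by
  have h1 := block_mul_add_le hg ha
  have h2 := mark_le π (2 ^ (H - g)) a b l r
  have h3 : 0 < 2 ^ (H - g) := by positivity
  rw [Nat.mul_left_comm]
  omega

theorem second_lt (hg : g ≤ H) (hb : b < 2 ^ g) (hv : Valid π k (2 ^ (H - g)) a b l r) :
    b * (8 * 2 ^ (H - g)) + (slab π (2 ^ (H - g)) a b l r - k) < 8 * 2 ^ H := by
  have h1 := block_mul_add_le hg hb
  have h3 : 0 < 2 ^ (H - g) := by positivity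
  have h4 := hv.2
  rw [Nat.mul_left_comm]
  omega

theorem key_div (hg : g ≤ H) (hb : b < 2 ^ g) (hv : Valid π k (2 ^ (H - g)) a b l r) :
    key π k H g a b l r / (8 * 2 ^ H) =
      g * (8 * 2 ^ H) + (a * (8 * 2 ^ (H - g)) + mark π (2 ^ (H - g)) a b l r) := by
  rw [key, mul_comm, Nat.mul_add_div (by positivity), Nat.div_eq_of_lt (second_lt hg hb hv),
    add_zero]

theorem key_level (hg : g ≤ H) (ha : a < 2 ^ g) (hb : b < 2 ^ g)
    (hv : Valid π k (2 ^ (H - g)) a b l r) :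
    key π k H g a b l r / (8 * 2 ^ H) / (8 * 2 ^ H) = g := by
  rw [key_div hg hb hv, mul_comm, Nat.mul_add_div (by positivity),
    Nat.div_eq_of_lt (first_lt hg ha), add_zero]

theorem key_first (hg : g ≤ H) (ha : a < 2 ^ g) (hb : b < 2 ^ g)
    (hv : Valid π k (2 ^ (H - g)) a b l r) :
    key π k H g a b l r / (8 * 2 ^ H) % (8 * 2 ^ H) =
      a * (8 * 2 ^ (H - g)) + mark π (2 ^ (H - g)) a b l r := by
  rw [key_div hg hb hv, mul_comm, Nat.mul_add_mod, Nat.mod_eq_of_lt (first_lt hg ha)]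

theorem key_second (hg : g ≤ H) (hb : b < 2 ^ g) (hv : Valid π k (2 ^ (H - g)) a b l r) :
    key π k H g a b l r % (8 * 2 ^ H) =
      b * (8 * 2 ^ (H - g)) + (slab π (2 ^ (H - g)) a b l r - k) := by
  rw [key, mul_comm, Nat.mul_add_mod, Nat.mod_eq_of_lt (second_lt hg hb hv)]

theorem mark_lt : mark π (2 ^ (H - g)) a b l r < 8 * 2 ^ (H - g) := by
  have h2 := mark_le π (2 ^ (H - g)) a b l r
  have h3 : 0 < 2 ^ (H - g) := by positivity
  omega

theorem excess_lt (hv : Valid π k (2 ^ (H - g)) a b l r) :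
    slab π (2 ^ (H - g)) a b l r - k < 8 * 2 ^ (H - g) := by
  have h3 : 0 < 2 ^ (H - g) := by positivity
  have h4 := hv.2
  omega

theorem key_a (hg : g ≤ H) (ha : a < 2 ^ g) (hb : b < 2 ^ g)
    (hv : Valid π k (2 ^ (H - g)) a b l r) :
    key π k H g a b l r / (8 * 2 ^ H) % (8 * 2 ^ H) / (8 * 2 ^ (H - g)) = a := by
  rw [key_first hg ha hb hv, mul_comm, Nat.mul_add_div (by positivity),
    Nat.div_eq_of_lt mark_lt, add_zero]

theorem key_b (hg : g ≤ H) (hb : b < 2 ^ g) (hv : Valid π k (2 ^ (H - g)) a b l r) :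
    key π k H g a b l r % (8 * 2 ^ H) / (8 * 2 ^ (H - g)) = b := by
  rw [key_second hg hb hv, mul_comm, Nat.mul_add_div (by positivity),
    Nat.div_eq_of_lt (excess_lt hv), add_zero]

theorem key_mark (hg : g ≤ H) (ha : a < 2 ^ g) (hb : b < 2 ^ g)
    (hv : Valid π k (2 ^ (H - g)) a b l r) :
    key π k H g a b l r / (8 * 2 ^ H) % (8 * 2 ^ H) % (8 * 2 ^ (H - g)) =
      mark π (2 ^ (H - g)) a b l r := by
  rw [key_first hg ha hb hv, mul_comm, Nat.mul_add_mod, Nat.mod_eq_of_lt mark_lt]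

theorem key_excess (hg : g ≤ H) (hb : b < 2 ^ g) (hv : Valid π k (2 ^ (H - g)) a b l r) :
    key π k H g a b l r % (8 * 2 ^ H) % (8 * 2 ^ (H - g)) =
      slab π (2 ^ (H - g)) a b l r - k := by
  rw [key_second hg hb hv, mul_comm, Nat.mul_add_mod, Nat.mod_eq_of_lt (excess_lt hv)]

theorem key_lt (hg : g ≤ H) (ha : a < 2 ^ g) (hb : b < 2 ^ g)
    (hv : Valid π k (2 ^ (H - g)) a b l r) :
    key π k H g a b l r < (g + 1) * (8 * 2 ^ H) * (8 * 2 ^ H) := by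
  rw [← Nat.div_lt_iff_lt_mul (by positivity), ← Nat.div_lt_iff_lt_mul (by positivity),
    key_level hg ha hb hv]
  exact Nat.lt_succ_self g

theorem le_key : g * (8 * 2 ^ H) * (8 * 2 ^ H) ≤ key π k H g a b l r := by
  rw [key, add_mul]
  omega

end Key

/-- The width of the interval of `x`-ranks `[l, r)`; `X` lists the `x`-coordinates in order. -/
def width (X : ℕ → ℝ) (l r : ℕ) : ℝ := X (r - 1) - X l

/-- Every entry `(L z, R z)` of the table is a valid interval at its own position; `R z = 0` marks
an empty entry. -/
def Sound (π : ℕ → ℕ) (n k H : ℕ) (L R : ℕ → ℕ) : Prop :=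
  ∀ z, R z ≠ 0 → ∃ g a b, g ≤ H ∧ a < 2 ^ g ∧ b < 2 ^ g ∧ L z ≤ n ∧ R z ≤ n ∧
    Valid π k (2 ^ (H - g)) a b (L z) (R z) ∧ z = key π k H g a b (L z) (R z)

/-- If the interval `[l, r)` is valid in the slab from `a` to `b` on level `g`, then its position
in the table has an entry that is not wider. -/
def Covered (π : ℕ → ℕ) (X : ℕ → ℝ) (k H : ℕ) (L R : ℕ → ℕ) (g a b l r : ℕ) : Prop :=
  Valid π k (2 ^ (H - g)) a b l r →
    R (key π k H g a b l r) ≠ 0 ∧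
      width X (L (key π k H g a b l r)) (R (key π k H g a b l r)) ≤ width X l r

/-- The entry at `z` is covered in the slabs of all pairs of halves of its two blocks. -/
def ChildrenCovered (π : ℕ → ℕ) (X : ℕ → ℝ) (k H : ℕ) (L R : ℕ → ℕ) (z : ℕ) : Prop :=
  ∀ g a b, g < H → a < 2 ^ g → b < 2 ^ g → Valid π k (2 ^ (H - g)) a b (L z) (R z) →
    z = key π k H g a b (L z) (R z) → ∀ da < 2, ∀ db < 2,
      Covered π X k H L R (g + 1) (2 * a + da) (2 * b + db) (L z) (R z)

/-- An interval with exactly `k` points in the rows `[y₁, y₂]` is valid for the blocks of `y₁` and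
`y₂`. -/
theorem valid_of_cnt_eq {π : ℕ → ℕ} {k m a b l r y₁ y₂ : ℕ} (hc : cnt π y₁ (y₂ + 1) l r = k)
    (hl : l ≤ r) (hy : y₁ ≤ y₂) (hy₁ : a * m ≤ y₁) (hy₁' : y₁ < a * m + m) (hy₂ : b * m ≤ y₂)
    (hy₂' : y₂ < b * m + m) : Valid π k m a b l r := by
  have c1 := cnt_add_below π y₁ (y₂ + 1) hl
  have c2 := cnt_add_below π (a * m) (b * m + m) hl
  have c3 := cnt_add_below π (a * m) y₁ hl
  have c4 := cnt_add_below π (y₂ + 1) (b * m + m) hl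
  have e1 := below_add π hy₁ (show y₁ ≤ y₂ + 1 by omega) l
  have e2 := below_add π hy₁ (show y₁ ≤ y₂ + 1 by omega) r
  have e3 := below_add π (show a * m ≤ y₂ + 1 by omega) (show y₂ + 1 ≤ b * m + m by omega) l
  have e4 := below_add π (show a * m ≤ y₂ + 1 by omega) (show y₂ + 1 ≤ b * m + m by omega) r
  have b1 := below_le π (a * m) y₁ r
  have b2 := below_le π (y₂ + 1) (b * m + m) r
  simp only [Valid, slab]
  omega

/-- A covered table contains, on every level and for every range of rows, an interval with
exactly `k` points that is at most as wide as any given one. -/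
theorem exists_entry {π : ℕ → ℕ} {X : ℕ → ℝ} {n k H : ℕ} {L R : ℕ → ℕ} (hk : 1 ≤ k)
    (hsound : Sound π n k H L R)
    (hroot : ∀ l < n, ∀ r < n, Covered π X k H L R 0 0 0 l (r + 1))
    (hchild : ∀ z, R z ≠ 0 → ChildrenCovered π X k H L R z)
    {y₁ y₂ l₀ r₀ : ℕ} (hy : y₁ ≤ y₂) (hy₂ : y₂ < 2 ^ H) (hr₀ : r₀ ≤ n)
    (hc : cnt π y₁ (y₂ + 1) l₀ r₀ = k) (g : ℕ) (hg : g ≤ H) :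
    ∃ z, R z ≠ 0 ∧ Valid π k (2 ^ (H - g)) (y₁ / 2 ^ (H - g)) (y₂ / 2 ^ (H - g)) (L z) (R z) ∧
      z = key π k H g (y₁ / 2 ^ (H - g)) (y₂ / 2 ^ (H - g)) (L z) (R z) ∧
      cnt π y₁ (y₂ + 1) (L z) (R z) = k ∧ width X (L z) (R z) ≤ width X l₀ r₀ := by
  -- an interval that is covered on level `g` yields an entry there
  have step : ∀ g ≤ H, ∀ l r, cnt π y₁ (y₂ + 1) l r = k →
      Covered π X k H L R g (y₁ / 2 ^ (H - g)) (y₂ / 2 ^ (H - g)) l r →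
      ∃ z, R z ≠ 0 ∧
        Valid π k (2 ^ (H - g)) (y₁ / 2 ^ (H - g)) (y₂ / 2 ^ (H - g)) (L z) (R z) ∧
        z = key π k H g (y₁ / 2 ^ (H - g)) (y₂ / 2 ^ (H - g)) (L z) (R z) ∧
        cnt π y₁ (y₂ + 1) (L z) (R z) = k ∧ width X (L z) (R z) ≤ width X l r := by
    intro g hg l r hlr hcov
    set m := 2 ^ (H - g) with hm
    have hm0 : 0 < m := by positivity
    have hlt : l < r := lt_of_cnt_pos (π := π) (y₁ := y₁) (y₂ := y₂ + 1) (by omega)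
    have d1 := Nat.div_mul_le_self y₁ m
    have d1' : y₁ < y₁ / m * m + m := by
      have := Nat.lt_div_mul_add (a := y₁) hm0; omega
    have d2 := Nat.div_mul_le_self y₂ m
    have d2' : y₂ < y₂ / m * m + m := by
      have := Nat.lt_div_mul_add (a := y₂) hm0; omega
    have hpow := two_pow_mul_block hg
    rw [← hm] at hpow
    have ha : y₁ / m < 2 ^ g := by
      rw [Nat.div_lt_iff_lt_mul hm0]; omega
    have hb : y₂ / m < 2 ^ g := by
      rw [Nat.div_lt_iff_lt_mul hm0]; omega
    have hv : Valid π k m (y₁ / m) (y₂ / m) l r :=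
      valid_of_cnt_eq hlr hlt.le hy d1 d1' d2 d2'
    obtain ⟨h1, h2⟩ := hcov hv
    set z := key π k H g (y₁ / m) (y₂ / m) l r with hz
    obtain ⟨g', a', b', hg', ha', hb', -, -, hv', hz'⟩ := hsound z h1
    -- the entry sits at the key of `[l, r)`, so the two intervals agree in all digits of the key
    have eg : g' = g := by
      rw [← key_level hg' ha' hb' hv', ← hz', hz, key_level hg ha hb hv]
    subst eg
    have ea : a' = y₁ / m := by
      rw [← key_a hg' ha' hb' hv', ← hz', hz, key_a hg ha hb hv]
    have eb : b' = y₂ / m := by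
      rw [← key_b hg' hb' hv', ← hz', hz, key_b hg hb hv]
    subst ea eb
    have es : mark π m (y₁ / m) (y₂ / m) l r = mark π m (y₁ / m) (y₂ / m) (L z) (R z) := by
      rw [hm, ← key_mark hg ha hb hv, ← key_mark hg ha hb hv', ← hz', hz]
    have ec : slab π m (y₁ / m) (y₂ / m) l r = slab π m (y₁ / m) (y₂ / m) (L z) (R z) := by
      have e1 := key_excess hg hb hv
      have e2 := key_excess hg hb hv'
      rw [← hz'] at e2
      rw [← hm, ← hz] at e1
      rw [← hm] at e2
      have p1 := hv.1
      have p2 := hv'.1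
      rw [← hm] at p2
      omega
    have hlt' : L z < R z := lt_of_cnt_pos (π := π) (y₁ := y₁ / m * m) (y₂ := y₂ / m * m + m) <| by
      have := hv'.1
      rw [← hm] at this
      unfold slab at this
      omega
    refine ⟨z, h1, hv', hz', ?_, h2⟩
    rw [← hlr]
    exact (cnt_eq_of_mark_eq hlt.le hlt'.le ec es d1 d1'.le (by omega) (by omega) (by omega)
      (Nat.div_le_div_right hy)).symm
  induction g with
  | zero =>
    have hlt : l₀ < r₀ := lt_of_cnt_pos (π := π) (y₁ := y₁) (y₂ := y₂ + 1) (by omega)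
    refine step 0 hg l₀ r₀ hc ?_
    have e1 : y₁ / 2 ^ (H - 0) = 0 := Nat.div_eq_of_lt (by simpa using by omega)
    have e2 : y₂ / 2 ^ (H - 0) = 0 := Nat.div_eq_of_lt (by simpa using by omega)
    rw [e1, e2]
    have := hroot l₀ (by omega) (r₀ - 1) (by omega)
    rwa [show r₀ - 1 + 1 = r₀ by omega] at this
  | succ g ih =>
    obtain ⟨z, h1, h2, h3, h4, h5⟩ := ih (by omega)
    have hm0 : 0 < 2 ^ (H - g) := by positivity
    have hpow := two_pow_mul_block (show g ≤ H by omega)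
    have ha : y₁ / 2 ^ (H - g) < 2 ^ g := by
      rw [Nat.div_lt_iff_lt_mul hm0]; omega
    have hb : y₂ / 2 ^ (H - g) < 2 ^ g := by
      rw [Nat.div_lt_iff_lt_mul hm0]; omega
    have half : ∀ y, ∃ d < 2, y / 2 ^ (H - (g + 1)) = 2 * (y / 2 ^ (H - g)) + d := by
      intro y
      refine ⟨y / 2 ^ (H - (g + 1)) % 2, Nat.mod_lt _ two_pos, ?_⟩
      rw [show H - g = H - (g + 1) + 1 by omega, pow_succ, ← Nat.div_div_eq_div_mul]
      omega
    obtain ⟨da, hda, ea⟩ := half y₁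
    obtain ⟨db, hdb, eb⟩ := half y₂
    have hcov := hchild z h1 g _ _ (by omega) ha hb h2 h3 da hda db hdb
    rw [← ea, ← eb] at hcov
    obtain ⟨z', k1, k2, k3, k4, k5⟩ := step (g + 1) hg _ _ h4 hcov
    exact ⟨z', k1, k2, k3, k4, k5.trans h5⟩

end EnclosingRect

/-! ### Entering a candidate into the table -/

namespace EnclosingRect
open RealRAM

/-- Entry `y * M + x` of the array of prefix counts, for `y * M` in register `y` and `x` in
register `x`. -/
def prefixCount (y x : ℕ) : WExpr := .get 2 (.add (.reg y) (.reg x))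

/-- The width of the interval of `x`-ranks whose ends are the values of two word expressions. -/
def widthExpr (l r : WExpr) : RExpr := .sub (.get 2 (.sub r (.lit 1))) (.get 2 l)

/-- Enter the interval `[l, r)` into the table for level `g` and the slab from block `a` to block
`b`, unless it is invalid there or the table has an entry for its key that is at most as wide.
The arguments `a`, `b`, `l`, `r`, `m = 2 ^ (H - g)`, `g` are in the word registers `10` to `15`. -/
def push : Prog :=
  .seq (.setW 20 (.mul (.mul (.reg 10) (.reg 14)) (.reg 4))) <|
  .seq (.setW 21 (.add (.reg 20) (.mul (.reg 14) (.reg 4)))) <|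
  .seq (.setW 22 (.mul (.mul (.reg 11) (.reg 14)) (.reg 4))) <|
  .seq (.setW 23 (.add (.reg 22) (.mul (.reg 14) (.reg 4)))) <|
  .seq (.setW 24 (.sub (.sub (prefixCount 23 13) (prefixCount 20 13))
    (.sub (prefixCount 23 12) (prefixCount 20 12)))) <|
  .ite (.and (.not (.wlt (.reg 24) (.reg 1)))
      (.not (.wlt (.add (.reg 1) (.mul (.lit 2) (.reg 14))) (.reg 24))))
    (.seq (.setW 25 (.add (.add (.add
        (.sub (prefixCount 21 12) (prefixCount 20 12))
        (.sub (prefixCount 23 12) (prefixCount 22 12)))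
        (.sub (prefixCount 21 13) (prefixCount 20 13)))
        (.sub (prefixCount 23 13) (prefixCount 22 13)))) <|
     .seq (.setW 26 (.add
        (.mul (.add (.mul (.reg 15) (.reg 4))
          (.add (.mul (.reg 10) (.mul (.lit 8) (.reg 14))) (.reg 25))) (.reg 4))
        (.add (.mul (.reg 11) (.mul (.lit 8) (.reg 14))) (.sub (.reg 24) (.reg 1))))) <|
     .ite (.or (.weq (.get 4 (.reg 26)) (.lit 0))
        (.rlt (widthExpr (.reg 12) (.reg 13))
          (widthExpr (.get 3 (.reg 26)) (.get 4 (.reg 26)))))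
       (.seq (.putW 3 (.reg 26) (.reg 12)) (.putW 4 (.reg 26) (.reg 13)))
       .skip)
    .skip

/-- The registers and arrays that remain unchanged after the preprocessing: the word registers `2`,
`3`, `4` hold `2 ^ H`, `H` and the base `8 * 2 ^ H`, the word array `1` holds the powers of two, the
word array `2` the prefix counts, and the real arrays `2` and `3` the sorted coordinates. -/
structure Env (n k H : ℕ) (π : ℕ → ℕ) (X Y : ℕ → ℝ) (s : State) : Prop where
  n_eq : s.wreg 0 = n
  k_eq : s.wreg 1 = k
  N_eq : s.wreg 2 = 2 ^ H
  H_eq : s.wreg 3 = H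
  M_eq : s.wreg 4 = 8 * 2 ^ H
  pow_eq : ∀ h ≤ H, s.warr 1 h = 2 ^ h
  count_eq : ∀ y ≤ 2 ^ H, ∀ x ≤ n, s.warr 2 (y * (8 * 2 ^ H) + x) = below π 0 y x
  X_eq : s.rarr 2 = X
  Y_eq : s.rarr 3 = Y

theorem Env.congr {n k H : ℕ} {π : ℕ → ℕ} {X Y : ℕ → ℝ} {s s' : State} (h : Env n k H π X Y s)
    (h1 : ∀ x < 5, s'.wreg x = s.wreg x) (h2 : ∀ a < 3, s'.warr a = s.warr a)
    (h3 : s'.rarr = s.rarr) : Env n k H π X Y s' where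
  n_eq := by rw [h1 _ (by norm_num), h.n_eq]
  k_eq := by rw [h1 _ (by norm_num), h.k_eq]
  N_eq := by rw [h1 _ (by norm_num), h.N_eq]
  H_eq := by rw [h1 _ (by norm_num), h.H_eq]
  M_eq := by rw [h1 _ (by norm_num), h.M_eq]
  pow_eq := by rw [h2 _ (by norm_num)]; exact h.pow_eq
  count_eq := by rw [h2 _ (by norm_num)]; exact h.count_eq
  X_eq := by rw [h3, h.X_eq]
  Y_eq := by rw [h3, h.Y_eq]

/-- Table `(L', R')` has an entry that is at most as wide wherever table `(L, R)` has one. -/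
def Improves (X : ℕ → ℝ) (L R L' R' : ℕ → ℕ) : Prop :=
  ∀ z, R z ≠ 0 → R' z ≠ 0 ∧ width X (L' z) (R' z) ≤ width X (L z) (R z)

theorem Improves.refl (X : ℕ → ℝ) (L R : ℕ → ℕ) : Improves X L R L R := fun _ h => ⟨h, le_rfl⟩

theorem Improves.trans {X : ℕ → ℝ} {L R L' R' L'' R'' : ℕ → ℕ} (h : Improves X L R L' R')
    (h' : Improves X L' R' L'' R'') : Improves X L R L'' R'' := fun z hz =>
  ⟨(h' z (h z hz).1).1, (h' z (h z hz).1).2.trans (h z hz).2⟩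

theorem Covered.of_improves {π : ℕ → ℕ} {X : ℕ → ℝ} {k H : ℕ} {L R L' R' : ℕ → ℕ} {g a b l r : ℕ}
    (h : Covered π X k H L R g a b l r) (hi : Improves X L R L' R') :
    Covered π X k H L' R' g a b l r := fun hv =>
  ⟨(hi _ (h hv).1).1, (hi _ (h hv).1).2.trans (h hv).2⟩

/-- The effect of `push`: the interval `[l, r)` is entered into the table for level `g` and the
slab from block `a` to block `b`. -/
structure Pushed (π : ℕ → ℕ) (X : ℕ → ℝ) (n k H g a b l r : ℕ) (s s' : State) : Prop where
  rreg_eq : s'.rreg = s.rreg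
  rarr_eq : s'.rarr = s.rarr
  wreg_eq : ∀ x < 20, s'.wreg x = s.wreg x
  warr_eq : ∀ a < 3, s'.warr a = s.warr a
  sound : Sound π n k H (s'.warr 3) (s'.warr 4)
  covered : Covered π X k H (s'.warr 3) (s'.warr 4) g a b l r
  improves : Improves X (s.warr 3) (s.warr 4) (s'.warr 3) (s'.warr 4)
  eq_of_lt : ∀ z < g * (8 * 2 ^ H) * (8 * 2 ^ H),
    s'.warr 3 z = s.warr 3 z ∧ s'.warr 4 z = s.warr 4 z

/-- Storing a valid interval at its own key keeps the table sound. -/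
theorem sound_update {π : ℕ → ℕ} {n k H g a b l r : ℕ} {L R : ℕ → ℕ} (h : Sound π n k H L R)
    (hg : g ≤ H) (ha : a < 2 ^ g) (hb : b < 2 ^ g) (hl : l ≤ n) (hr : r ≤ n)
    (hv : Valid π k (2 ^ (H - g)) a b l r) :
    Sound π n k H (Function.update L (key π k H g a b l r) l)
      (Function.update R (key π k H g a b l r) r) := by
  intro z hz
  by_cases hzk : z = key π k H g a b l r
  · subst hzk
    simp only [Function.update_self]
    exact ⟨g, a, b, hg, ha, hb, hl, hr, hv, rfl⟩
  · simp only [Function.update_of_ne hzk] at hz ⊢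
    exact h z hz

theorem improves_update {X : ℕ → ℝ} {L R : ℕ → ℕ} {z l r : ℕ} (hr : r ≠ 0)
    (h : R z = 0 ∨ width X l r < width X (L z) (R z)) :
    Improves X L R (Function.update L z l) (Function.update R z r) := by
  intro z' hz'
  by_cases hzk : z' = z
  · subst hzk
    simp only [Function.update_self]
    exact ⟨hr, (h.resolve_left hz').le⟩
  · simp only [Function.update_of_ne hzk]
    exact ⟨hz', le_rfl⟩

theorem push_runs {π : ℕ → ℕ} {X Y : ℕ → ℝ} {n k H g a b l r B : ℕ} {s : State}
    (hB : (H + 2) * (8 * 2 ^ H) * (8 * 2 ^ H) < B) (hk : 1 ≤ k) (hn : n ≤ 2 ^ H) (hkn : k ≤ n)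
    (hs : Env n k H π X Y s) (hsound : Sound π n k H (s.warr 3) (s.warr 4))
    (hg : g ≤ H) (ha : a < 2 ^ g) (hb : b < 2 ^ g) (hl : l ≤ n) (hr : r ≤ n)
    (h10 : s.wreg 10 = a) (h11 : s.wreg 11 = b) (h12 : s.wreg 12 = l) (h13 : s.wreg 13 = r)
    (h14 : s.wreg 14 = 2 ^ (H - g)) (h15 : s.wreg 15 = g) :
    Runs B push s push.bound (Pushed π X n k H g a b l r s) := by
  have hA := block_mul_add_le hg ha
  have hBb := block_mul_add_le hg hb
  have hm0 : 0 < 2 ^ (H - g) := by positivity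
  have hkey := fun hv => key_lt (π := π) (k := k) (l := l) (r := r) hg ha hb hv
  have hM := hs.M_eq
  have hk1 := hs.k_eq
  have hX := hs.X_eq
  have hkeydef := key.eq_def π k H g a b l r
  have hvdef := Valid.eq_def π k (2 ^ (H - g)) a b l r
  have hmark := mark_le π (2 ^ (H - g)) a b l r
  have hmarkdef := mark.eq_def π (2 ^ (H - g)) a b l r
  have hN0 : 0 < 2 ^ H := by positivity
  have hcount := hs.count_eq
  set m := 2 ^ (H - g) with hm
  set N := 2 ^ H with hN
  set M := 8 * N with hMN
  have b1 : a * m * M + m * M ≤ N * M := by rw [← add_mul]; exact Nat.mul_le_mul_right _ hA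
  have b2 : b * m * M + m * M ≤ N * M := by rw [← add_mul]; exact Nat.mul_le_mul_right _ hBb
  have b3 : M * M = 8 * (N * M) := by rw [hMN]; ring
  have b4 : (H + 2) * M * M = H * M * M + 2 * (M * M) := by ring
  have b5 : N ≤ N * M := Nat.le_mul_of_pos_right _ (by omega)
  have b6 : M ≤ M * M := Nat.le_mul_of_pos_right _ (by omega)
  have b7 : g * M * M ≤ H * M * M := Nat.mul_le_mul_right _ (Nat.mul_le_mul_right _ hg)
  have b8 : m * M ≤ N * M := by omega
  have cA : ∀ x ≤ n, s.warr 2 (a * m * M + x) = below π 0 (a * m) x :=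
    fun x hx => hcount _ (by omega) x hx
  have cA' : ∀ x ≤ n, s.warr 2 (a * m * M + m * M + x) = below π 0 (a * m + m) x := by
    intro x hx
    rw [← add_mul]
    exact hcount _ (by omega) x hx
  have cB : ∀ x ≤ n, s.warr 2 (b * m * M + x) = below π 0 (b * m) x :=
    fun x hx => hcount _ (by omega) x hx
  have cB' : ∀ x ≤ n, s.warr 2 (b * m * M + m * M + x) = below π 0 (b * m + m) x := by
    intro x hx
    rw [← add_mul]
    exact hcount _ (by omega) x hx
  apply Runs.of_wp
  -- the intermediate results of the address computation are below the word bound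
  have f1 : a * (8 * m) + mark π m a b l r < M := first_lt hg ha
  have f2 : Valid π k m a b l r → b * (8 * m) + (slab π m a b l r - k) < M := second_lt hg hb
  have d1 := fun x => below_le π (a * m) (a * m + m) x
  have d2 := fun x => below_le π (b * m) (b * m + m) x
  have d3 := fun x => below_le π (a * m) (b * m + m) x
  have d4 := below_sub_below_eq_cnt π (a * m) (b * m + m) l r
  have d1l := d1 l
  have d1r := d1 r
  have d2l := d2 l
  have d2r := d2 r
  have d3l := d3 l
  have d3r := d3 r
  have hslab : slab π m a b l r = cnt π (a * m) (b * m + m) l r := rfl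
  have hRle : ∀ z, s.warr 4 z ≤ n := by
    intro z
    by_cases hz : s.warr 4 z = 0
    · omega
    · obtain ⟨_, _, _, _, _, _, _, h, _⟩ := hsound z hz
      exact h
  simp only [push, Prog.wp, prefixCount, widthExpr, WExpr.Ok, WExpr.val, RExpr.Ok, RExpr.val,
    Test.Ok, Test.Holds, State.setW_wreg, State.setW_warr, State.setW_rarr,
    State.putW_wreg, h10, h11, h12, h13, h14, h15, hM, hk1, hX]
  simp (disch := assumption) only [Nat.reduceEqDiff, ↓reduceIte, cA, cA', cB,
    cB', below_sub_below, below_sub_below_eq_cnt, true_and, and_true, ← hmarkdef, ← hslab,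
    ← hkeydef, not_lt, ← hvdef]
  -- the goal is now a list of absences of overflow, followed by the two branches
  refine ⟨⟨by omega, by omega⟩, ⟨by omega, by omega⟩, ⟨by omega, by omega⟩, ⟨by omega, by omega⟩,
    ⟨⟨by omega, by omega, by omega⟩, ⟨by omega, by omega, by omega⟩, by omega⟩,
    ⟨⟨by omega, by omega⟩, by omega⟩, fun hv => ?_, fun hv => ?_⟩
  · have hkey' := hkey hv
    have f2' := f2 hv
    have e1 : g * M ≤ g * M * M := Nat.le_mul_of_pos_right _ (by omega)
    have e2 : (g * M + (a * (8 * m) + mark π m a b l r)) * M ≤ key π k H g a b l r := by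
      rw [hkeydef]; omega
    have e3 : (g + 1) * M * M = g * M * M + M * M := by ring
    have hr0 : r ≠ 0 := by
      have : l < r := lt_of_cnt_pos (π := π) (y₁ := a * m) (y₂ := b * m + m) (by
        have := hv.1; omega)
      omega
    refine ⟨⟨⟨⟨⟨by omega, by omega, by omega⟩, ⟨by omega, by omega, by omega⟩, by omega⟩,
      ⟨by omega, by omega, by omega⟩, by omega⟩, ⟨by omega, by omega, by omega⟩, by omega⟩,
      ⟨⟨⟨by omega, ⟨⟨⟨by omega, by omega⟩, by omega⟩, by omega⟩, by omega⟩, by omega⟩,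
        ⟨⟨⟨by omega, by omega⟩, by omega⟩, by omega, by omega⟩, by omega⟩,
      ⟨by omega, ⟨by omega, by omega⟩, by omega, ?_⟩, fun hw => ?_, fun hw => ?_⟩
    · have := hRle (key π k H g a b l r)
      omega
    · refine ⟨rfl, rfl, ?_, ?_, ?_, ?_, ?_, ?_⟩
      · intro x hx
        simp only [State.putW_wreg, State.setW_wreg]
        rw [if_neg (by omega), if_neg (by omega), if_neg (by omega), if_neg (by omega),
          if_neg (by omega), if_neg (by omega), if_neg (by omega)]
      · intro x hx
        simp only [State.putW_warr, State.setW_warr]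
        rw [if_neg (by omega), if_neg (by omega)]
      all_goals simp only [State.putW_warr, State.setW_warr, Nat.reduceEqDiff, ↓reduceIte]
      · exact sound_update hsound hg ha hb hl hr hv
      · intro _
        simp [hr0]
      · exact improves_update hr0 hw
      · intro z hz
        have : z ≠ key π k H g a b l r := (hz.trans_le le_key).ne
        simp [Function.update_of_ne this]
    · refine ⟨rfl, rfl, ?_, fun _ _ => rfl, hsound, ?_, .refl _ _ _, fun _ _ => ⟨rfl, rfl⟩⟩
      · intro x hx
        simp only [State.setW_wreg]
        rw [if_neg (by omega), if_neg (by omega), if_neg (by omega), if_neg (by omega),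
          if_neg (by omega), if_neg (by omega), if_neg (by omega)]
      · intro _
        simp only [State.setW_warr]
        push Not at hw
        exact ⟨hw.1, hw.2⟩
  · refine ⟨rfl, rfl, ?_, fun _ _ => rfl, hsound, fun hv' => absurd hv' hv, .refl _ _ _,
      fun _ _ => ⟨rfl, rfl⟩⟩
    intro x hx
    simp only [State.setW_wreg]
    rw [if_neg (by omega), if_neg (by omega), if_neg (by omega), if_neg (by omega),
      if_neg (by omega)]

end EnclosingRect

/-! ### Passing candidates on and comparing rectangles -/

namespace EnclosingRect
open RealRAM

/-- The effect of some calls of `push` since the state `s₀`, all for level `g` and the interval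
`[l, r)`: the pairs of blocks in `D` have been dealt with. -/
structure PushedAll (π : ℕ → ℕ) (X : ℕ → ℝ) (n k H g l r : ℕ) (D : ℕ → ℕ → Prop)
    (s₀ s : State) : Prop where
  rreg_eq : s.rreg = s₀.rreg
  rarr_eq : s.rarr = s₀.rarr
  wreg_eq : ∀ x < 10, s.wreg x = s₀.wreg x
  warr_eq : ∀ a < 3, s.warr a = s₀.warr a
  l_eq : s.wreg 12 = l
  r_eq : s.wreg 13 = r
  m_eq : s.wreg 14 = 2 ^ (H - g)
  g_eq : s.wreg 15 = g
  sound : Sound π n k H (s.warr 3) (s.warr 4)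
  covered : ∀ a b, D a b → Covered π X k H (s.warr 3) (s.warr 4) g a b l r
  improves : Improves X (s₀.warr 3) (s₀.warr 4) (s.warr 3) (s.warr 4)
  eq_of_lt : ∀ z < g * (8 * 2 ^ H) * (8 * 2 ^ H),
    s.warr 3 z = s₀.warr 3 z ∧ s.warr 4 z = s₀.warr 4 z

theorem PushedAll.setW {π : ℕ → ℕ} {X : ℕ → ℝ} {n k H g l r : ℕ} {D : ℕ → ℕ → Prop}
    {s₀ s : State} (h : PushedAll π X n k H g l r D s₀ s) {x : ℕ} (hx : x = 10 ∨ x = 11) (v : ℕ) :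
    PushedAll π X n k H g l r D s₀ (s.setW x v) where
  rreg_eq := h.rreg_eq
  rarr_eq := h.rarr_eq
  wreg_eq y hy := by rw [State.setW_wreg, if_neg (by omega), h.wreg_eq y hy]
  warr_eq := h.warr_eq
  l_eq := by rw [State.setW_wreg, if_neg (by omega), h.l_eq]
  r_eq := by rw [State.setW_wreg, if_neg (by omega), h.r_eq]
  m_eq := by rw [State.setW_wreg, if_neg (by omega), h.m_eq]
  g_eq := by rw [State.setW_wreg, if_neg (by omega), h.g_eq]
  sound := h.sound
  covered := h.covered
  improves := h.improves
  eq_of_lt := h.eq_of_lt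

section
variable {π : ℕ → ℕ} {X Y : ℕ → ℝ} {n k H B : ℕ}

theorem push_runs_all {g a b l r : ℕ} {D : ℕ → ℕ → Prop} {s₀ s : State}
    (hB : (H + 2) * (8 * 2 ^ H) * (8 * 2 ^ H) < B) (hk : 1 ≤ k) (hn : n ≤ 2 ^ H) (hkn : k ≤ n)
    (hs : Env n k H π X Y s₀) (hg : g ≤ H) (ha : a < 2 ^ g) (hb : b < 2 ^ g) (hl : l ≤ n)
    (hr : r ≤ n) (h : PushedAll π X n k H g l r D s₀ s)
    (h10 : s.wreg 10 = a) (h11 : s.wreg 11 = b) :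
    Runs B push s push.bound (fun s' =>
      PushedAll π X n k H g l r (fun a' b' => D a' b' ∨ a' = a ∧ b' = b) s₀ s' ∧
        s'.wreg 10 = a ∧ s'.wreg 11 = b) := by
  have hs' : Env n k H π X Y s :=
    hs.congr (fun x hx => h.wreg_eq x (by omega)) h.warr_eq h.rarr_eq
  refine (push_runs hB hk hn hkn hs' h.sound hg ha hb hl hr h10 h11 h.l_eq h.r_eq h.m_eq
    h.g_eq).mono le_rfl fun s' p => ⟨?_, ?_, ?_⟩
  · refine ⟨p.rreg_eq.trans h.rreg_eq, p.rarr_eq.trans h.rarr_eq,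
      fun x hx => (p.wreg_eq x (by omega)).trans (h.wreg_eq x hx),
      fun a ha => (p.warr_eq a ha).trans (h.warr_eq a ha),
      (p.wreg_eq _ (by norm_num)).trans h.l_eq, (p.wreg_eq _ (by norm_num)).trans h.r_eq,
      (p.wreg_eq _ (by norm_num)).trans h.m_eq, (p.wreg_eq _ (by norm_num)).trans h.g_eq,
      p.sound, ?_, h.improves.trans p.improves, fun z hz =>
        ⟨(p.eq_of_lt z hz).1.trans (h.eq_of_lt z hz).1,
          (p.eq_of_lt z hz).2.trans (h.eq_of_lt z hz).2⟩⟩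
    rintro a' b' (hd | ⟨rfl, rfl⟩)
    · exact (h.covered a' b' hd).of_improves p.improves
    · exact p.covered
  · rw [p.wreg_eq _ (by norm_num), h10]
  · rw [p.wreg_eq _ (by norm_num), h11]

/-- Pass the interval `[l, r)` on to the four pairs of halves of its blocks. For a single block,
this includes the pair of its upper and its lower half, whose slab is empty, so that no interval is
valid there. -/
def pushChildren : Prog :=
  .seq (.seq (.setW 14 (.div (.reg 14) (.lit 2))) <|
    .seq (.setW 15 (.add (.reg 15) (.lit 1))) <|
    .seq (.setW 10 (.add (.reg 10) (.reg 10))) <| .setW 11 (.add (.reg 11) (.reg 11))) <|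
  .seq push <| .seq (.setW 10 (.add (.reg 10) (.lit 1))) <|
  .seq push <| .seq (.setW 11 (.add (.reg 11) (.lit 1))) <|
  .seq push <| .seq (.setW 10 (.sub (.reg 10) (.lit 1))) push

theorem pushChildren_runs {g a b l r : ℕ} {s : State}
    (hB : (H + 2) * (8 * 2 ^ H) * (8 * 2 ^ H) < B) (hk : 1 ≤ k) (hn : n ≤ 2 ^ H) (hkn : k ≤ n)
    (hs : Env n k H π X Y s) (hsound : Sound π n k H (s.warr 3) (s.warr 4))
    (hg : g < H) (ha : a < 2 ^ g) (hb : b < 2 ^ g) (hl : l ≤ n) (hr : r ≤ n)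
    (h10 : s.wreg 10 = a) (h11 : s.wreg 11 = b) (h12 : s.wreg 12 = l) (h13 : s.wreg 13 = r)
    (h14 : s.wreg 14 = 2 ^ (H - g)) (h15 : s.wreg 15 = g) :
    Runs B pushChildren s pushChildren.bound (fun s' =>
      ∃ D : ℕ → ℕ → Prop, PushedAll π X n k H (g + 1) l r D s s' ∧
        ∀ da < 2, ∀ db < 2, D (2 * a + da) (2 * b + db)) := by
  have hpow : 2 ^ (g + 1) ≤ 2 ^ H := Nat.pow_le_pow_right two_pos hg
  have hpow' : 2 ^ (g + 1) = 2 * 2 ^ g := by ring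
  have hm : 2 ^ (H - g) = 2 * 2 ^ (H - (g + 1)) := by
    rw [← pow_succ']; congr 1; omega
  have hm' : 2 ^ (H - g) ≤ 2 ^ H := Nat.pow_le_pow_right two_pos (by omega)
  have hBH : 16 * 2 ^ H < B ∧ H + 2 < B := by
    have h1 : 0 < 2 ^ H := by positivity
    have h2 : 2 * (8 * 2 ^ H) * 1 ≤ (H + 2) * (8 * 2 ^ H) * (8 * 2 ^ H) :=
      Nat.mul_le_mul (Nat.mul_le_mul_right _ (by omega)) (by omega)
    have h3 : (H + 2) * 1 * 1 ≤ (H + 2) * (8 * 2 ^ H) * (8 * 2 ^ H) :=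
      Nat.mul_le_mul (Nat.mul_le_mul_left _ (by omega)) (by omega)
    omega
  have hN : 0 < 2 ^ H := by positivity
  have hrun := fun {a b : ℕ} {D : ℕ → ℕ → Prop} {s' : State} (ha : a < 2 ^ (g + 1))
    (hb : b < 2 ^ (g + 1)) => push_runs_all (a := a) (b := b) (D := D) (s := s') hB hk hn hkn hs
      (g := g + 1) hg ha hb hl hr
  have set10 : ∀ {D : ℕ → ℕ → Prop} {s' : State} {e : WExpr} {a b : ℕ}, e.Ok B s' →
      e.val s' = a → PushedAll π X n k H (g + 1) l r D s s' → s'.wreg 11 = b →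
      Runs B (.setW 10 e) s' (Prog.bound (.setW 10 e)) (fun s' =>
        PushedAll π X n k H (g + 1) l r D s s' ∧ s'.wreg 10 = a ∧ s'.wreg 11 = b) :=
    fun ok h1 h2 h3 => Runs.of_wp ⟨ok, h2.setW (.inl rfl) _, by simpa using h1, by simpa using h3⟩
  have set11 : ∀ {D : ℕ → ℕ → Prop} {s' : State} {e : WExpr} {a b : ℕ}, e.Ok B s' →
      e.val s' = b → PushedAll π X n k H (g + 1) l r D s s' → s'.wreg 10 = a →
      Runs B (.setW 11 e) s' (Prog.bound (.setW 11 e)) (fun s' =>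
        PushedAll π X n k H (g + 1) l r D s s' ∧ s'.wreg 10 = a ∧ s'.wreg 11 = b) :=
    fun ok h1 h2 h3 => Runs.of_wp ⟨ok, h2.setW (.inr rfl) _, by simpa using h3, by simpa using h1⟩
  refine Runs.seq (R := fun s' => PushedAll π X n k H (g + 1) l r (fun _ _ => False) s s' ∧
    s'.wreg 10 = 2 * a ∧ s'.wreg 11 = 2 * b) (Runs.of_wp ?_) ?_
  · simp only [Prog.wp, WExpr.Ok, WExpr.val, State.setW_wreg, h10, h11, h14, h15, true_and,
      Nat.reduceEqDiff, ↓reduceIte]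
    refine ⟨⟨by omega, by norm_num, by omega⟩, ⟨by omega, by omega⟩, by omega, by omega,
      ⟨rfl, rfl, fun x hx => ?_, fun _ _ => rfl, ?_, ?_, ?_, ?_, hsound, fun _ _ h => h.elim,
        .refl _ _ _, fun _ _ => ⟨rfl, rfl⟩⟩, by omega, by omega⟩
    · simp only [State.setW_wreg]
      rw [if_neg (by omega), if_neg (by omega), if_neg (by omega), if_neg (by omega)]
    · simp [h12]
    · simp [h13]
    · simp only [State.setW_wreg, Nat.reduceEqDiff, ↓reduceIte]
      omega
    · simp
  rintro s1 ⟨p1, q1, r1⟩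
  refine (hrun (by omega) (by omega) p1 q1 r1).seq ?_
  rintro s2 ⟨p2, q2, r2⟩
  refine (set10 (a := 2 * a + 1) (by
    simp only [WExpr.Ok, WExpr.val, q2, true_and]; omega) (by simp [WExpr.val, q2]) p2 r2).seq ?_
  rintro s3 ⟨p3, q3, r3⟩
  refine (hrun (by omega) (by omega) p3 q3 r3).seq ?_
  rintro s4 ⟨p4, q4, r4⟩
  refine (set11 (b := 2 * b + 1) (by
    simp only [WExpr.Ok, WExpr.val, r4, true_and]; omega) (by simp [WExpr.val, r4]) p4 q4).seq ?_
  rintro s5 ⟨p5, q5, r5⟩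
  refine (hrun (by omega) (by omega) p5 q5 r5).seq ?_
  rintro s6 ⟨p6, q6, r6⟩
  refine (set10 (a := 2 * a) (by
    simp only [WExpr.Ok, WExpr.val, q6, true_and]; omega) (by simp [WExpr.val, q6]) p6 r6).seq ?_
  rintro s7 ⟨p7, q7, r7⟩
  refine (hrun (by omega) (by omega) p7 q7 r7).mono le_rfl ?_
  rintro s8 ⟨p8, -, -⟩
  refine ⟨_, p8, fun da hda db hdb => ?_⟩
  interval_cases da <;> interval_cases db <;> simp

/-- The real expression `F e f` computes the score of a rectangle of width `e` and height `f`. -/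
def Computes (F : RExpr → RExpr → RExpr) (sc : ℝ → ℝ → ℝ) : Prop :=
  ∀ (B : ℕ) (s : State) (e f : RExpr), e.Ok B s → f.Ok B s →
    (F e f).Ok B s ∧ (F e f).val s = sc (e.val s) (f.val s)

/-- Compare the rectangle with `x`-ranks `[l, r)` and rows `[a, b]` with the best one so far. -/
def compareBest (F : RExpr → RExpr → RExpr) : Prog :=
  .ite (.and (.wlt (.reg 11) (.reg 0))
      (.rlt (F (widthExpr (.reg 12) (.reg 13)) (.sub (.get 3 (.reg 11)) (.get 3 (.reg 10))))
        (F (.sub (.reg 1) (.reg 0)) (.sub (.reg 3) (.reg 2)))))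
    (.seq (.setR 0 (.get 2 (.reg 12))) <|
     .seq (.setR 1 (.get 2 (.sub (.reg 13) (.lit 1)))) <|
     .seq (.setR 2 (.get 3 (.reg 10))) <| .setR 3 (.get 3 (.reg 11)))
    .skip

/-- The score of the rectangle in the output registers. -/
def bestScore (sc : ℝ → ℝ → ℝ) (s : State) : ℝ := sc (s.rreg 1 - s.rreg 0) (s.rreg 3 - s.rreg 2)

/-- The output registers hold a rectangle whose sides pass through points and that contains at
least `k` points. -/
def HoldsRect (π : ℕ → ℕ) (X Y : ℕ → ℝ) (n k : ℕ) (s : State) : Prop :=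
  ∃ a b l r, a ≤ b ∧ b < n ∧ l < r ∧ r ≤ n ∧ k ≤ cnt π a (b + 1) l r ∧
    s.rreg 0 = X l ∧ s.rreg 1 = X (r - 1) ∧ s.rreg 2 = Y a ∧ s.rreg 3 = Y b

theorem compareBest_runs {F : RExpr → RExpr → RExpr} {sc : ℝ → ℝ → ℝ} (hF : Computes F sc)
    {a b l r : ℕ} {s : State} (hB : 1 < B) (hnB : n < B) (hk : 1 ≤ k)
    (hs : Env n k H π X Y s) (hbest : HoldsRect π X Y n k s) (hr : r ≤ n)
    (hv : Valid π k 1 a b l r)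
    (h10 : s.wreg 10 = a) (h11 : s.wreg 11 = b) (h12 : s.wreg 12 = l) (h13 : s.wreg 13 = r) :
    Runs B (compareBest F) s (compareBest F).bound (fun s' =>
      s'.wreg = s.wreg ∧ s'.warr = s.warr ∧ s'.rarr = s.rarr ∧ HoldsRect π X Y n k s' ∧
        bestScore sc s' ≤ bestScore sc s ∧
        (b < n → bestScore sc s' ≤ sc (width X l r) (Y b - Y a))) := by
  have hslab : k ≤ cnt π a (b + 1) l r := by simpa [slab] using hv.1
  have hab := row_lt_of_cnt_pos (show 0 < cnt π a (b + 1) l r by omega)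
  have hlr := lt_of_cnt_pos (show 0 < cnt π a (b + 1) l r by omega)
  apply Runs.of_wp
  obtain ⟨o1, v1⟩ := hF B s (widthExpr (.reg 12) (.reg 13))
    (.sub (.get 3 (.reg 11)) (.get 3 (.reg 10)))
    (by
      simp only [widthExpr, RExpr.Ok, WExpr.Ok, WExpr.val, h13, true_and, and_true]
      omega)
    (by simp [RExpr.Ok, WExpr.Ok])
  obtain ⟨o2, v2⟩ := hF B s (.sub (.reg 1) (.reg 0)) (.sub (.reg 3) (.reg 2))
    (by simp [RExpr.Ok]) (by simp [RExpr.Ok])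
  have v1' : (F (widthExpr (.reg 12) (.reg 13)) (.sub (.get 3 (.reg 11)) (.get 3 (.reg 10)))).val s
      = sc (width X l r) (Y b - Y a) := by
    rw [v1]
    simp [widthExpr, RExpr.val, WExpr.val, h10, h11, h12, h13, hs.X_eq, hs.Y_eq, width]
  have v2' : (F (.sub (.reg 1) (.reg 0)) (.sub (.reg 3) (.reg 2))).val s = bestScore sc s := v2
  simp only [compareBest, Prog.wp, Test.Ok, Test.Holds, o1, o2, v1', v2', WExpr.val, WExpr.Ok,
    RExpr.Ok, RExpr.val, State.setR_wreg, h10, h11, h12, h13, hs.n_eq, hs.X_eq,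
    hs.Y_eq, true_and, State.setR_rarr]
  refine ⟨fun h => ⟨⟨hB, by omega⟩, rfl,
    ⟨a, b, l, r, by omega, h.1, hlr, hr, hslab, ?_⟩, ?_, fun _ => ?_⟩,
    fun h => ⟨hbest, le_rfl, fun hb => ?_⟩⟩
  · simp
  · simpa [bestScore, width] using h.2.le
  · simp [bestScore, width]
  · push Not at h
    exact h hb

end

end EnclosingRect

/-! ### The pass over the table -/

namespace EnclosingRect
open RealRAM

theorem key_inj {π : ℕ → ℕ} {k H g a b l r g' a' b' l' r' : ℕ} (hg : g ≤ H) (ha : a < 2 ^ g)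
    (hb : b < 2 ^ g) (hv : Valid π k (2 ^ (H - g)) a b l r) (hg' : g' ≤ H) (ha' : a' < 2 ^ g')
    (hb' : b' < 2 ^ g') (hv' : Valid π k (2 ^ (H - g')) a' b' l' r')
    (h : key π k H g a b l r = key π k H g' a' b' l' r') : g = g' ∧ a = a' ∧ b = b' := by
  have eg : g = g' := by rw [← key_level hg ha hb hv, h, key_level hg' ha' hb' hv']
  subst eg
  refine ⟨rfl, ?_, ?_⟩
  · rw [← key_a hg ha hb hv, h, key_a hg' ha' hb' hv']
  · rw [← key_b hg hb hv, h, key_b hg' hb' hv']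

/-- Read the table entry at the position in register `5`, and recover its level and its blocks
from the position. -/
def decode : Prog :=
  .seq (.setW 16 (.div (.reg 5) (.reg 4))) <|
  .seq (.setW 15 (.div (.reg 16) (.reg 4))) <|
  .seq (.setW 14 (.get 1 (.sub (.reg 3) (.reg 15)))) <|
  .seq (.setW 10 (.div (.mod (.reg 16) (.reg 4)) (.mul (.lit 8) (.reg 14)))) <|
  .seq (.setW 11 (.div (.mod (.reg 5) (.reg 4)) (.mul (.lit 8) (.reg 14)))) <|
  .seq (.setW 12 (.get 3 (.reg 5))) (.setW 13 (.get 4 (.reg 5)))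

section
variable {π : ℕ → ℕ} {X Y : ℕ → ℝ} {n k H B : ℕ}

theorem decode_runs {g a b z : ℕ} {s : State}
    (hB : (H + 2) * (8 * 2 ^ H) * (8 * 2 ^ H) < B) (hs : Env n k H π X Y s)
    (hg : g ≤ H) (ha : a < 2 ^ g) (hb : b < 2 ^ g)
    (hv : Valid π k (2 ^ (H - g)) a b (s.warr 3 z) (s.warr 4 z))
    (hz : z = key π k H g a b (s.warr 3 z) (s.warr 4 z)) (h5 : s.wreg 5 = z) :
    Runs B decode s decode.bound (fun s' =>
      s'.rreg = s.rreg ∧ s'.rarr = s.rarr ∧ s'.warr = s.warr ∧ (∀ x < 10, s'.wreg x = s.wreg x) ∧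
        s'.wreg 10 = a ∧ s'.wreg 11 = b ∧ s'.wreg 12 = s.warr 3 z ∧ s'.wreg 13 = s.warr 4 z ∧
        s'.wreg 14 = 2 ^ (H - g) ∧ s'.wreg 15 = g) := by
  have e1 := key_level hg ha hb hv
  have e2 := key_a hg ha hb hv
  have e3 := key_b hg hb hv
  have e4 := key_lt hg ha hb hv
  rw [← hz] at e1 e2 e3 e4
  have hM0 : 0 < 8 * 2 ^ H := by positivity
  have hm0 : 0 < 8 * 2 ^ (H - g) := by positivity
  have hm : 8 * 2 ^ (H - g) ≤ 8 * 2 ^ H :=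
    Nat.mul_le_mul_left _ (Nat.pow_le_pow_right two_pos (by omega))
  have hzB : z < B := by
    refine lt_trans (lt_of_lt_of_le e4 ?_) hB
    exact Nat.mul_le_mul_right _ (Nat.mul_le_mul_right _ (by omega))
  have hMB : 8 * 2 ^ H < B := by
    refine lt_of_le_of_lt ?_ hB
    calc 8 * 2 ^ H = 1 * (8 * 2 ^ H) * 1 := by ring
      _ ≤ _ := Nat.mul_le_mul (Nat.mul_le_mul_right _ (by omega)) (by omega)
  have hHB : H < B := by
    refine lt_of_le_of_lt ?_ hB
    calc H ≤ (H + 2) * 1 * 1 := by omega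
      _ ≤ _ := Nat.mul_le_mul (Nat.mul_le_mul_left _ (by omega)) (by omega)
  have f1 : z / (8 * 2 ^ H) ≤ z := Nat.div_le_self _ _
  have f2 : z % (8 * 2 ^ H) < 8 * 2 ^ H := Nat.mod_lt _ hM0
  have f3 : z / (8 * 2 ^ H) % (8 * 2 ^ H) < 8 * 2 ^ H := Nat.mod_lt _ hM0
  have f4 : a ≤ z / (8 * 2 ^ H) % (8 * 2 ^ H) := by
    rw [← e2]; exact Nat.div_le_self _ _
  have f5 : b ≤ z % (8 * 2 ^ H) := by
    rw [← e3]; exact Nat.div_le_self _ _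
  apply Runs.of_wp
  simp only [decode, Prog.wp, WExpr.Ok, WExpr.val, State.setW_wreg, State.setW_warr, h5, hs.M_eq,
    hs.H_eq, true_and, Nat.reduceEqDiff, ↓reduceIte, e1, e2, e3,
    hs.pow_eq _ (Nat.sub_le H g), State.setW_rreg, State.setW_rarr, and_true]
  refine ⟨⟨by omega, by omega⟩, ⟨by omega, by omega⟩, by omega, ⟨⟨by omega, by omega⟩,
    ⟨by omega, by omega⟩, by omega, by omega⟩, ⟨⟨by omega, by omega⟩,
    ⟨by omega, by omega⟩, by omega, by omega⟩, ?_⟩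
  intro x hx
  rw [if_neg (by omega), if_neg (by omega), if_neg (by omega), if_neg (by omega),
    if_neg (by omega), if_neg (by omega), if_neg (by omega)]

/-- Deal with the table entry at the position in register `5`: compare it with the best rectangle
if its blocks are single rows, and pass it on to the next level otherwise. -/
def processEntry (F : RExpr → RExpr → RExpr) : Prog :=
  .ite (.weq (.get 4 (.reg 5)) (.lit 0)) .skip <|
    .seq decode (.ite (.wlt (.reg 15) (.reg 3)) pushChildren (compareBest F))

/-- The invariant of the main loop: all table positions below `z` have been dealt with. -/
structure LoopInv (π : ℕ → ℕ) (X Y : ℕ → ℝ) (n k H : ℕ) (sc : ℝ → ℝ → ℝ) (z : ℕ) (s : State) :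
    Prop where
  env : Env n k H π X Y s
  sound : Sound π n k H (s.warr 3) (s.warr 4)
  root : ∀ l < n, ∀ r < n, Covered π X k H (s.warr 3) (s.warr 4) 0 0 0 l (r + 1)
  children : ∀ z' < z, s.warr 4 z' ≠ 0 → ChildrenCovered π X k H (s.warr 3) (s.warr 4) z'
  leaf : ∀ z' < z, s.warr 4 z' ≠ 0 → ∀ a b, a < 2 ^ H → b < 2 ^ H → b < n →
    Valid π k (2 ^ (H - H)) a b (s.warr 3 z') (s.warr 4 z') →
    z' = key π k H H a b (s.warr 3 z') (s.warr 4 z') →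
    bestScore sc s ≤ sc (width X (s.warr 3 z') (s.warr 4 z')) (Y b - Y a)
  best : HoldsRect π X Y n k s

theorem HoldsRect.congr {s s' : State} (h : HoldsRect π X Y n k s) (h' : s'.rreg = s.rreg) :
    HoldsRect π X Y n k s' := by
  rwa [HoldsRect, h']

theorem bestScore_congr {sc : ℝ → ℝ → ℝ} {s s' : State} (h : s'.rreg = s.rreg) :
    bestScore sc s' = bestScore sc s := by
  rw [bestScore, h, bestScore]

theorem processEntry_runs {F : RExpr → RExpr → RExpr} {sc : ℝ → ℝ → ℝ} (hF : Computes F sc)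
    {z : ℕ} {s : State}
    (hB : (H + 2) * (8 * 2 ^ H) * (8 * 2 ^ H) < B) (hk : 1 ≤ k) (hn : n ≤ 2 ^ H) (hkn : k ≤ n)
    (hs : LoopInv π X Y n k H sc z s) (h5 : s.wreg 5 = z) :
    Runs B (processEntry F) s (processEntry F).bound (fun s' =>
      s'.wreg 5 = z ∧ LoopInv π X Y n k H sc (z + 1) s') := by
  have hB' : n < B ∧ 1 < B := by
    have h1 : 0 < 2 ^ H := by positivity
    have h2 : 2 * (8 * 2 ^ H) * 1 ≤ (H + 2) * (8 * 2 ^ H) * (8 * 2 ^ H) :=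
      Nat.mul_le_mul (Nat.mul_le_mul_right _ (by omega)) (by omega)
    omega
  refine Runs.ite (by simp only [Test.Ok, WExpr.Ok, true_and]; omega) (fun h => ?_) (fun h => ?_)
  · refine Runs.of_wp (p := .skip) ⟨h5, hs.env, hs.sound, hs.root, ?_, ?_, hs.best⟩
    all_goals
      simp only [Test.Holds, WExpr.val, h5] at h
      intro z' hz' hz0
      have hlt : z' < z := by
        rcases Nat.lt_succ_iff_lt_or_eq.mp hz' with h' | rfl
        · exact h'
        · exact absurd h hz0
    · exact hs.children z' hlt hz0
    · exact hs.leaf z' hlt hz0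
  simp only [Test.Holds, WExpr.val, h5] at h
  obtain ⟨g, a, b, hg, ha, hb, hl, hr, hv, hz⟩ := hs.sound z h
  refine (decode_runs hB hs.env hg ha hb hv hz h5).seq ?_
  rintro s' ⟨d1, d2, d3, d4, d10, d11, d12, d13, d14, d15⟩
  have henv : Env n k H π X Y s' :=
    hs.env.congr (fun x hx => d4 x (by omega)) (fun a _ => by rw [d3]) d2
  refine Runs.ite ⟨trivial, trivial⟩ (fun hgH => ?_) (fun hgH => ?_)
  · simp only [Test.Holds, WExpr.val, d15, henv.H_eq] at hgH
    refine (pushChildren_runs hB hk hn hkn henv (by rw [d3]; exact hs.sound) hgH ha hb hl hr d10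
      d11 d12 d13 d14 d15).mono le_rfl ?_
    rintro s'' ⟨D, p, hD⟩
    have peq := p.eq_of_lt
    have pimp := p.improves
    rw [d3] at peq pimp
    have hrr : s''.rreg = s.rreg := p.rreg_eq.trans d1
    have hzlt : z < (g + 1) * (8 * 2 ^ H) * (8 * 2 ^ H) := by
      have := key_lt hg ha hb hv
      rwa [← hz] at this
    refine ⟨by rw [p.wreg_eq _ (by norm_num), d4 _ (by norm_num), h5],
      henv.congr (fun x hx => p.wreg_eq x (by omega)) p.warr_eq p.rarr_eq, p.sound,
      fun l hl r hr => (hs.root l hl r hr).of_improves pimp, ?_, ?_,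
      hs.best.congr hrr⟩
    · intro z' hz' hz0
      obtain ⟨q1, q2⟩ := peq z' (by omega)
      rw [q2] at hz0
      rcases Nat.lt_succ_iff_lt_or_eq.mp hz' with h' | rfl
      · intro g' a' b' hg' ha' hb' hv' hzz' da hda db hdb
        rw [q1, q2] at hv' hzz' ⊢
        exact (hs.children z' h' hz0 g' a' b' hg' ha' hb' hv' hzz' da hda db hdb).of_improves pimp
      · intro g' a' b' hg' ha' hb' hv' hzz' da hda db hdb
        rw [q1, q2] at hv' hzz' ⊢
        obtain ⟨rfl, rfl, rfl⟩ := key_inj hg ha hb hv hg'.le ha' hb' hv' (hz.symm.trans hzz')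
        exact p.covered _ _ (hD da hda db hdb)
    · intro z' hz' hz0 a' b' ha' hb' hbn hv' hzz'
      obtain ⟨q1, q2⟩ := peq z' (by omega)
      rw [q2] at hz0
      rw [q1, q2] at hv' hzz' ⊢
      rw [bestScore_congr hrr]
      rcases Nat.lt_succ_iff_lt_or_eq.mp hz' with h' | rfl
      · exact hs.leaf z' h' hz0 a' b' ha' hb' hbn hv' hzz'
      · have := (key_inj hg ha hb hv le_rfl ha' hb' hv' (hz.symm.trans hzz')).1
        omega
  · simp only [Test.Holds, WExpr.val, d15, henv.H_eq] at hgH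
    obtain rfl : g = H := by omega
    have hv1 : Valid π k 1 a b (s.warr 3 z) (s.warr 4 z) := by simpa using hv
    refine (compareBest_runs hF hB'.2 hB'.1 hk henv (hs.best.congr d1) hr hv1 d10 d11 d12
      d13).mono le_rfl ?_
    rintro s'' ⟨c1, c2, c3, c4, c5, c6⟩
    rw [bestScore_congr d1] at c5
    rw [d3] at c2
    refine ⟨by rw [c1, d4 _ (by norm_num), h5],
      henv.congr (fun x hx => by rw [c1]) (fun a _ => by rw [c2, d3]) c3, ?_, ?_, ?_, ?_, c4⟩
    all_goals rw [c2]
    · exact hs.sound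
    · exact hs.root
    · intro z' hz' hz0
      rcases Nat.lt_succ_iff_lt_or_eq.mp hz' with h' | rfl
      · exact hs.children z' h' hz0
      · intro g' a' b' hg' ha' hb' hv' hzz'
        have := (key_inj le_rfl ha hb hv hg'.le ha' hb' hv' (hz.symm.trans hzz')).1
        omega
    · intro z' hz' hz0 a' b' ha' hb' hbn hv' hzz'
      rcases Nat.lt_succ_iff_lt_or_eq.mp hz' with h' | rfl
      · exact c5.trans (hs.leaf z' h' hz0 a' b' ha' hb' hbn hv' hzz')
      · obtain ⟨-, rfl, rfl⟩ := key_inj le_rfl ha hb hv le_rfl ha' hb' hv' (hz.symm.trans hzz')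
        exact c6 hbn

/-- The number of table positions. -/
def tableSize : WExpr := .mul (.mul (.add (.reg 3) (.lit 1)) (.reg 4)) (.reg 4)

theorem processAll_runs {F : RExpr → RExpr → RExpr} {sc : ℝ → ℝ → ℝ} (hF : Computes F sc)
    {s : State}
    (hB : (H + 2) * (8 * 2 ^ H) * (8 * 2 ^ H) < B) (hk : 1 ≤ k) (hn : n ≤ 2 ^ H) (hkn : k ≤ n)
    (hs : LoopInv π X Y n k H sc 0 s) :
    Runs B (.for 5 tableSize (processEntry F)) s
      (forTime tableSize ((H + 1) * (8 * 2 ^ H) * (8 * 2 ^ H)) (processEntry F).bound)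
      (LoopInv π X Y n k H sc ((H + 1) * (8 * 2 ^ H) * (8 * 2 ^ H))) := by
  have h1 : 0 < 2 ^ H := by positivity
  have hle : (H + 1) * (8 * 2 ^ H) * (8 * 2 ^ H) ≤ (H + 2) * (8 * 2 ^ H) * (8 * 2 ^ H) :=
    Nat.mul_le_mul_right _ (Nat.mul_le_mul_right _ (by omega))
  have h2 : (H + 1) * (8 * 2 ^ H) ≤ (H + 1) * (8 * 2 ^ H) * (8 * 2 ^ H) :=
    Nat.le_mul_of_pos_right _ (by omega)
  have h3 : (H + 1) ≤ (H + 1) * (8 * 2 ^ H) := Nat.le_mul_of_pos_right _ (by omega)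
  have h4 : 8 * 2 ^ H ≤ (H + 1) * (8 * 2 ^ H) := Nat.le_mul_of_pos_left _ (by omega)
  refine Runs.for (by omega) (by omega) ?_ ?_ ?_ hs
  · intro z s hs
    simp only [tableSize, WExpr.Ok, WExpr.val, hs.env.H_eq, hs.env.M_eq, true_and, and_true]
    omega
  · intro z s v hs
    refine ⟨hs.env.congr (fun x hx => ?_) (fun _ _ => rfl) rfl, hs.sound, hs.root, hs.children,
      hs.leaf, hs.best⟩
    rw [State.setW_wreg, if_neg (by omega)]
  · intro z _ s hs h5
    exact processEntry_runs hF hB hk hn hkn hs h5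

end

end EnclosingRect

/-! ### Powers of two and ranks -/

namespace EnclosingRect
open RealRAM

/-- The number of indices `j < m` that come before `i` when indices are sorted by `x`, with ties
broken by the index. -/
noncomputable def rankUpTo (x : ℕ → ℝ) (m i : ℕ) : ℕ := by
  classical exact ((Finset.range m).filter fun j => x j < x i ∨ (x j = x i ∧ j < i)).card

section Rank
variable {x : ℕ → ℝ} {n i j : ℕ}

theorem rankUpTo_zero : rankUpTo x 0 i = 0 := by simp [rankUpTo]

theorem rankUpTo_succ_of_before {m : ℕ} (h : x m < x i ∨ (x m = x i ∧ m < i)) :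
    rankUpTo x (m + 1) i = rankUpTo x m i + 1 := by
  classical
  simp [rankUpTo, Finset.range_add_one, Finset.filter_insert, h]

theorem rankUpTo_succ_of_not_before {m : ℕ} (h : ¬ (x m < x i ∨ (x m = x i ∧ m < i))) :
    rankUpTo x (m + 1) i = rankUpTo x m i := by
  classical
  simp only [rankUpTo, Finset.range_add_one, Finset.filter_insert, if_neg h]

theorem rankUpTo_le (m : ℕ) : rankUpTo x m i ≤ m := by
  classical
  exact (Finset.card_filter_le _ _).trans (by simp)

theorem rankUpTo_lt_of_before (hi : i < n) (h : x i < x j ∨ (x i = x j ∧ i < j)) :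
    rankUpTo x n i < rankUpTo x n j := by
  classical
  apply Finset.card_lt_card
  rw [Finset.ssubset_iff_of_subset]
  · exact ⟨i, by simp [hi, h], by simp⟩
  · apply Finset.monotone_filter_right
    rintro m - (h1 | ⟨h1, h2⟩) <;> rcases h with h3 | ⟨h3, h4⟩
    · exact .inl (h1.trans h3)
    · exact .inl (h3 ▸ h1)
    · exact .inl (h1 ▸ h3)
    · exact .inr ⟨h1.trans h3, h2.trans h4⟩

theorem before_trichotomy (x : ℕ → ℝ) (i j : ℕ) :
    (x i < x j ∨ (x i = x j ∧ i < j)) ∨ i = j ∨ (x j < x i ∨ (x j = x i ∧ j < i)) := by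
  rcases lt_trichotomy (x i) (x j) with h | h | h
  · exact .inl (.inl h)
  · rcases lt_trichotomy i j with h' | h' | h'
    · exact .inl (.inr ⟨h, h'⟩)
    · exact .inr (.inl h')
    · exact .inr (.inr (.inr ⟨h.symm, h'⟩))
  · exact .inr (.inr (.inl h))

theorem rankUpTo_lt (hi : i < n) : rankUpTo x n i < n := by
  classical
  calc rankUpTo x n i < (Finset.range n).card := by
        apply Finset.card_lt_card
        rw [Finset.ssubset_iff_of_subset (Finset.filter_subset _ _)]
        exact ⟨i, by simp [hi], by simp⟩
    _ = n := by simp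

theorem rankUpTo_inj (hi : i < n) (hj : j < n) (h : rankUpTo x n i = rankUpTo x n j) : i = j := by
  rcases before_trichotomy x i j with h' | h' | h'
  · exact absurd h (rankUpTo_lt_of_before hi h').ne
  · exact h'
  · exact absurd h (rankUpTo_lt_of_before hj h').ne'

theorem le_of_rankUpTo_le (hj : j < n) (h : rankUpTo x n i ≤ rankUpTo x n j) : x i ≤ x j := by
  by_contra! h'
  have := rankUpTo_lt_of_before (x := x) hj (.inl h')
  omega

theorem exists_rankUpTo_eq {r : ℕ} (hr : r < n) : ∃ i < n, rankUpTo x n i = r := by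
  have := Finset.surj_on_of_inj_on_of_card_le (s := Finset.range n) (t := Finset.range n)
    (fun i _ => rankUpTo x n i) (fun i hi => by simpa using rankUpTo_lt (by simpa using hi))
    (fun i j hi hj h => rankUpTo_inj (by simpa using hi) (by simpa using hj) h) le_rfl r
    (by simpa using hr)
  obtain ⟨i, hi, h⟩ := this
  exact ⟨i, by simpa using hi, h.symm⟩

end Rank

/-- The state after the computation of the powers of two. The input is still in place, and the
table (word array `4`) is empty. -/
structure Base (n k H : ℕ) (x y : ℕ → ℝ) (s : State) : Prop where
  n_eq : s.wreg 0 = n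
  k_eq : s.wreg 1 = k
  N_eq : s.wreg 2 = 2 ^ H
  H_eq : s.wreg 3 = H
  M_eq : s.wreg 4 = 8 * 2 ^ H
  pow_eq : ∀ h ≤ H, s.warr 1 h = 2 ^ h
  x_eq : s.rarr 0 = x
  y_eq : s.rarr 1 = y
  table_eq : s.warr 4 = fun _ => 0

theorem Base.congr {n k H : ℕ} {x y : ℕ → ℝ} {s s' : State} (h : Base n k H x y s)
    (h1 : ∀ x < 5, s'.wreg x = s.wreg x) (h2 : s'.warr 1 = s.warr 1)
    (h3 : ∀ a < 2, s'.rarr a = s.rarr a) (h4 : s'.warr 4 = s.warr 4) : Base n k H x y s' where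
  n_eq := by rw [h1 _ (by norm_num), h.n_eq]
  k_eq := by rw [h1 _ (by norm_num), h.k_eq]
  N_eq := by rw [h1 _ (by norm_num), h.N_eq]
  H_eq := by rw [h1 _ (by norm_num), h.H_eq]
  M_eq := by rw [h1 _ (by norm_num), h.M_eq]
  pow_eq := by rw [h2]; exact h.pow_eq
  x_eq := by rw [h3 _ (by norm_num), h.x_eq]
  y_eq := by rw [h3 _ (by norm_num), h.y_eq]
  table_eq := by rw [h4, h.table_eq]

/-- Compute the powers of two up to the first one that is at least `n`. -/
def powers : Prog :=
  .seq (.seq (.setW 2 (.lit 1)) (.putW 1 (.lit 0) (.lit 1))) <|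
  .seq (.while (.wlt (.reg 2) (.reg 0))
    (.seq (.setW 2 (.add (.reg 2) (.reg 2))) <| .seq (.setW 3 (.add (.reg 3) (.lit 1))) <|
      .putW 1 (.reg 3) (.reg 2)))
  (.setW 4 (.mul (.lit 8) (.reg 2)))

section
variable {n k B : ℕ}

theorem powers_runs : ∃ K, ∀ (n k B : ℕ) (s : State) (x y : ℕ → ℝ),
    8 * 2 ^ Nat.clog 2 n < B → Nat.clog 2 n < B → s.wreg 0 = n → s.wreg 1 = k → s.wreg 3 = 0 →
    s.rarr 0 = x → s.rarr 1 = y → s.warr 2 = (fun _ => 0) → s.warr 4 = (fun _ => 0) →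
    Runs B powers s (K * (Nat.clog 2 n + 1)) (fun s' =>
      Base n k (Nat.clog 2 n) x y s' ∧ s'.warr 2 = fun _ => 0) := by
  refine ⟨100, fun n k B s x y hB hHB h0 h1 h3 hx hy hw2 hw4 => ?_⟩
  have hpos : ∀ h : ℕ, 0 < 2 ^ h := fun h => by positivity
  set H := Nat.clog 2 n with hH
  let I : ℕ → State → Prop := fun i s =>
    s.wreg 0 = n ∧ s.wreg 1 = k ∧ s.wreg 2 = 2 ^ i ∧ s.wreg 3 = i ∧
      (∀ h ≤ i, s.warr 1 h = 2 ^ h) ∧ s.rarr 0 = x ∧ s.rarr 1 = y ∧ s.warr 2 = (fun _ => 0) ∧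
      s.warr 4 = (fun _ => 0)
  have hlast := hpos H
  refine Runs.mono (Runs.seq (R := I 0) (Runs.of_wp ?_) fun s1 hs1 => Runs.seq (R := I H)
    (Runs.while (I := I) (T := 12) ?_ ?_ hs1) fun s2 hs2 =>
      Runs.of_wp (p := .setW 4 (.mul (.lit 8) (.reg 2))) ?_) ?_ fun _ h => h
  · simp only [Prog.wp, WExpr.Ok, WExpr.val]
    refine ⟨by omega, ⟨by omega, by omega⟩, ?_⟩
    simp [I, h0, h1, h3, hx, hy, hw2, hw4]
  · rintro i hi s ⟨e0, e1, e2, e3, e4, e5, e6, e7, e8⟩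
    refine ⟨⟨trivial, trivial⟩, ?_, ?_⟩
    · simp only [Test.Holds, WExpr.val, e0, e2]
      exact (Nat.lt_clog_iff_pow_lt (by norm_num)).mp hi
    · have hle : 2 ^ (i + 1) ≤ 2 ^ H := Nat.pow_le_pow_right two_pos hi
      have hpi := hpos i
      rw [pow_succ] at hle
      refine (Runs.of_wp (p := .seq _ _) ?_).mono (T' := 12) (by decide) fun _ h => h
      simp only [Prog.wp, WExpr.Ok, WExpr.val, State.setW_wreg, e2, e3, true_and,
        Nat.reduceEqDiff, ↓reduceIte, and_true]
      refine ⟨by omega, ⟨by omega, by omega⟩, ?_⟩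
      refine ⟨by simp [e0], by simp [e1], by simp [pow_succ, mul_two], by simp, ?_, by simp [e5],
        by simp [e6], by simp [e7], by simp [e8]⟩
      intro h hh
      simp only [State.putW_warr, State.setW_warr, ↓reduceIte, Function.update_apply]
      split_ifs with hhi
      · rw [hhi, pow_succ]; ring
      · exact e4 h (by omega)
  · rintro s ⟨e0, e1, e2, e3, e4, e5, e6, e7, e8⟩
    refine ⟨⟨trivial, trivial⟩, ?_⟩
    simp only [Test.Holds, WExpr.val, e0, e2, not_lt]
    exact Nat.le_pow_clog (by norm_num) n
  · obtain ⟨e0, e1, e2, e3, e4, e5, e6, e7, e8⟩ := hs2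
    refine ⟨⟨by simp only [WExpr.Ok]; omega, trivial, by simpa [WExpr.val, e2] using hB⟩, ?_, ?_⟩
    · exact ⟨by simp [e0], by simp [e1], by simp [e2], by simp [e3], by simp [WExpr.val, e2],
        by simpa using e4, by simp [e5], by simp [e6], by simp [e8]⟩
    · simp [e7]
  · simp only [Prog.bound, WExpr.cost, Test.cost]
    omega

/-- The test whether point `j` (register `6`) comes before point `i` (register `5`) when points are
sorted by the coordinates in the real array `a`. -/
def beforeTest (a : ℕ) : Test :=
  .or (.rlt (.get a (.reg 6)) (.get a (.reg 5)))
    (.and (.req (.get a (.reg 6)) (.get a (.reg 5))) (.wlt (.reg 6) (.reg 5)))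

/-- Count point `j` in the ranks of point `i`, which are accumulated in the word registers `7` and
`8`. -/
def countRanksStep : Prog :=
  .seq (.ite (beforeTest 0) (.setW 7 (.add (.reg 7) (.lit 1))) .skip)
    (.ite (beforeTest 1) (.setW 8 (.add (.reg 8) (.lit 1))) .skip)

/-- Store the coordinates of point `i` at its ranks. -/
def storePoint : Prog :=
  .seq (.putR 2 (.reg 7) (.get 0 (.reg 5))) <| .seq (.putR 3 (.reg 8) (.get 1 (.reg 5))) <|
    .putW 0 (.reg 8) (.reg 7)

/-- Compute the ranks of point `i` (register `5`), and store the point there. -/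
def rankPoint : Prog :=
  .seq (.seq (.setW 7 (.lit 0)) (.setW 8 (.lit 0))) <|
  .seq (.for 6 (.reg 0) countRanksStep) storePoint

/-- Sort the points by both coordinates, by counting for each point those that come before it. The
real arrays `2` and `3` receive the sorted coordinates, the word array `0` the `x`-rank of the
point in each row. -/
def sortPoints : Prog := .for 5 (.reg 0) rankPoint

/-- The coordinates of the points `i < m` are stored at their ranks. -/
def Sorted (n m : ℕ) (x y : ℕ → ℝ) (s : State) : Prop :=
  ∀ i < m, s.rarr 2 (rankUpTo x n i) = x i ∧ s.rarr 3 (rankUpTo y n i) = y i ∧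
    s.warr 0 (rankUpTo y n i) = rankUpTo x n i

/-- The invariant of the inner loop of `sortPoints`. -/
structure RankInv (n k H : ℕ) (x y : ℕ → ℝ) (i j : ℕ) (s : State) : Prop where
  base : Base n k H x y s
  count_eq : s.warr 2 = fun _ => 0
  sorted : Sorted n i x y s
  i_eq : s.wreg 5 = i
  x_rank : s.wreg 7 = rankUpTo x j i
  y_rank : s.wreg 8 = rankUpTo y j i

theorem countRanksStep_runs {H i j : ℕ} {x y : ℕ → ℝ} {s : State} (hB : n + 1 < B) (hj : j < n)
    (hs : RankInv n k H x y i j s) (h6 : s.wreg 6 = j) :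
    Runs B countRanksStep s countRanksStep.bound (fun s' =>
      s'.wreg 6 = j ∧ RankInv n k H x y i (j + 1) s') := by
  have h1 := rankUpTo_le (x := x) (i := i) j
  have h2 := rankUpTo_le (x := y) (i := i) j
  have upd : ∀ (s : State) (v c : ℕ), (c = 7 ∨ c = 8) → Base n k H x y s →
      Base n k H x y (s.setW c v) := by
    intro s v c hc hb
    refine hb.congr (fun x hx => ?_) rfl (fun _ _ => rfl) rfl
    rw [State.setW_wreg, if_neg (by omega)]
  refine Runs.seq (R := fun s' => s'.wreg 6 = j ∧ Base n k H x y s' ∧ s'.warr 2 = (fun _ => 0) ∧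
    Sorted n i x y s' ∧ s'.wreg 5 = i ∧ s'.wreg 7 = rankUpTo x (j + 1) i ∧
    s'.wreg 8 = rankUpTo y j i) (Runs.of_wp ?_) fun s' hs' => Runs.of_wp ?_
  · simp only [Prog.wp, beforeTest, Test.Ok, Test.Holds, RExpr.Ok, WExpr.Ok, RExpr.val,
      WExpr.val, hs.i_eq, h6, hs.base.x_eq, true_and, hs.x_rank, and_true]
    refine ⟨fun h => ⟨⟨by omega, by omega⟩, ?_⟩, fun h => ?_⟩
    · exact ⟨by simp [h6], upd _ _ _ (.inl rfl) hs.base, hs.count_eq, hs.sorted,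
        by simp [hs.i_eq], by simp [rankUpTo_succ_of_before h], by simp [hs.y_rank]⟩
    · exact ⟨hs.base, hs.count_eq, hs.sorted, by rw [rankUpTo_succ_of_not_before h],
        hs.y_rank⟩
  · obtain ⟨e6, eb, e2, es, e5, e7, e8⟩ := hs'
    simp only [Prog.wp, beforeTest, Test.Ok, Test.Holds, RExpr.Ok, WExpr.Ok, RExpr.val,
      WExpr.val, e5, e6, eb.y_eq, true_and, e8, and_true]
    refine ⟨fun h => ⟨⟨by omega, by omega⟩, ?_⟩, fun h => ?_⟩
    · exact ⟨by simp [e6], upd _ _ _ (.inr rfl) eb, e2, es, by simp [e5], by simp [e7],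
        by simp [rankUpTo_succ_of_before h]⟩
    · exact ⟨eb, e2, es, e5, e7, by rw [rankUpTo_succ_of_not_before h, e8]⟩

theorem sortPoints_runs : ∃ K, ∀ (n k H B : ℕ) (s : State) (x y : ℕ → ℝ), n + 1 < B →
    Base n k H x y s → s.warr 2 = (fun _ => 0) →
    Runs B sortPoints s (K * ((n + 1) * (n + 1))) (fun s' =>
      Base n k H x y s' ∧ s'.warr 2 = (fun _ => 0) ∧ Sorted n n x y s') := by
  refine ⟨100 + countRanksStep.bound, fun n k H B s x y hB hs hs2 => ?_⟩
  refine Runs.mono (Runs.for (T := 4 + (forTime (.reg 0) n countRanksStep.bound + 20)) (c := n)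
    (I := fun i s => Base n k H x y s ∧ s.warr 2 = (fun _ => 0) ∧ Sorted n i x y s)
    (by omega) (by omega) ?_ ?_ ?_ ⟨hs, hs2, fun i hi => absurd hi (Nat.not_lt_zero i)⟩) ?_
    fun _ h => h
  · rintro i s ⟨h1, -⟩
    exact ⟨trivial, h1.n_eq⟩
  · rintro i s v ⟨h1, h2, h3⟩
    refine ⟨h1.congr (fun x hx => ?_) rfl (fun _ _ => rfl) rfl, h2, h3⟩
    rw [State.setW_wreg, if_neg (by omega)]
  · rintro i hi s ⟨h1, h2, h3⟩ h5
    refine Runs.seq (R := RankInv n k H x y i 0) ((Runs.of_wp ?_).mono (T := Prog.bound _)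
      (by decide) fun _ h => h) fun s1 hs1 => Runs.seq (R := RankInv n k H x y i n)
      (Runs.for (by omega) (by omega) ?_ ?_ ?_ hs1) fun s2 hs2 =>
        (Runs.of_wp ?_).mono (T := Prog.bound _) (by decide) fun _ h => h
    · simp only [Prog.wp, WExpr.Ok, WExpr.val]
      refine ⟨by omega, by omega, h1.congr (fun x hx => ?_) rfl (fun _ _ => rfl) rfl, h2, h3,
        by simp [h5], by simp [rankUpTo_zero], by simp [rankUpTo_zero]⟩
      rw [State.setW_wreg, State.setW_wreg, if_neg (by omega), if_neg (by omega)]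
    · intro j s hs
      exact ⟨trivial, hs.base.n_eq⟩
    · intro j s v hs
      refine ⟨hs.base.congr (fun x hx => ?_) rfl (fun _ _ => rfl) rfl, hs.count_eq, hs.sorted,
        by simp [hs.i_eq], by simp [hs.x_rank], by simp [hs.y_rank]⟩
      rw [State.setW_wreg, if_neg (by omega)]
    · intro j hj s hs h6
      exact countRanksStep_runs hB hj hs h6
    · simp only [storePoint, Prog.wp, WExpr.Ok, WExpr.val, RExpr.Ok, RExpr.val, hs2.i_eq,
        hs2.x_rank, hs2.y_rank, State.putR_wreg, State.putR_rarr, hs2.base.x_eq, hs2.base.y_eq,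
        true_and, Nat.reduceEqDiff, ↓reduceIte]
      refine ⟨by simp [hs2.i_eq], hs2.base.congr (fun _ _ => rfl) (by simp) ?_ (by simp),
        by simp [hs2.count_eq], ?_⟩
      · intro a ha
        simp only [State.putW_rarr, State.putR_rarr]
        rw [if_neg (by omega), if_neg (by omega)]
      · intro m hm
        rcases Nat.lt_succ_iff_lt_or_eq.mp hm with hm | rfl
        · have e1 : rankUpTo x n m ≠ rankUpTo x n i := fun h =>
            hm.ne (rankUpTo_inj (hm.trans hi) hi h)
          have e2 : rankUpTo y n m ≠ rankUpTo y n i := fun h =>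
            hm.ne (rankUpTo_inj (hm.trans hi) hi h)
          simpa [Function.update_apply, e1, e2] using hs2.sorted m hm
        · simp
  · simp only [forTime, WExpr.cost]
    nlinarith

end

end EnclosingRect

/-! ### Prefix counts, the top level, and the whole program -/

namespace EnclosingRect
open RealRAM

/-- The `x`-rank of the point in row `y`, as stored in the array `pr`; the rows `y ≥ n` contain no
point, which is encoded by the value `n`. -/
def rowRank (n : ℕ) (pr : ℕ → ℕ) (y : ℕ) : ℕ := if y < n then pr y else n

theorem rowRank_lt_iff {n x : ℕ} {pr : ℕ → ℕ} (hx : x ≤ n) (y : ℕ) :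
    rowRank n pr y < x ↔ y < n ∧ pr y < x := by
  unfold rowRank
  split_ifs with h
  · simp [h]
  · simp only [h, false_and, iff_false]
    omega

/-- Entry of the array of prefix counts for the row and the `x`-rank in the registers `5` and
`6`. -/
def oldCount : WExpr := .get 2 (.add (.mul (.reg 5) (.reg 4)) (.reg 6))

/-- Position in the array of prefix counts for the next row and the same `x`-rank. -/
def newIndex : WExpr := .add (.mul (.add (.reg 5) (.lit 1)) (.reg 4)) (.reg 6)

/-- Extend a prefix count by one row. -/
def countStep : Prog :=
  .ite (.and (.wlt (.reg 5) (.reg 0)) (.wlt (.get 0 (.reg 5)) (.reg 6)))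
    (.putW 2 newIndex (.add oldCount (.lit 1))) (.putW 2 newIndex oldCount)

/-- Compute, row by row, how many points lie below each row and to the left of each `x`-rank. -/
def countPoints : Prog :=
  .for 5 (.reg 2) (.for 6 (.add (.reg 0) (.lit 1)) countStep)

/-- The invariant of the outer loop of `countPoints`: the first `m + 1` rows of the array of prefix
counts are correct. -/
structure CountInv (n k H : ℕ) (x y : ℕ → ℝ) (pr : ℕ → ℕ) (X Y : ℕ → ℝ) (m : ℕ) (s : State) :
    Prop where
  base : Base n k H x y s
  pr_eq : s.warr 0 = pr
  X_eq : s.rarr 2 = X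
  Y_eq : s.rarr 3 = Y
  count_eq : ∀ j ≤ m, ∀ i ≤ n, s.warr 2 (j * (8 * 2 ^ H) + i) = below (rowRank n pr) 0 j i

theorem CountInv.setW {n k H : ℕ} {x y : ℕ → ℝ} {pr : ℕ → ℕ} {X Y : ℕ → ℝ} {m : ℕ} {s : State}
    (h : CountInv n k H x y pr X Y m s) {c : ℕ} (hc : 5 ≤ c) (v : ℕ) :
    CountInv n k H x y pr X Y m (s.setW c v) := by
  refine ⟨h.base.congr (fun x hx => ?_) rfl (fun _ _ => rfl) rfl, h.pr_eq, h.X_eq, h.Y_eq,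
    h.count_eq⟩
  rw [State.setW_wreg, if_neg (by omega)]

theorem countStep_runs {n k H B m i : ℕ} {x y : ℕ → ℝ} {pr : ℕ → ℕ} {X Y : ℕ → ℝ} {s : State}
    (hB : (H + 2) * (8 * 2 ^ H) * (8 * 2 ^ H) < B) (hn : n ≤ 2 ^ H) (hm : m < 2 ^ H) (hi : i ≤ n)
    (hs : CountInv n k H x y pr X Y m s)
    (hrow : ∀ i' < i, s.warr 2 ((m + 1) * (8 * 2 ^ H) + i') =
      below (rowRank n pr) 0 (m + 1) i') (h5 : s.wreg 5 = m) (h6 : s.wreg 6 = i) :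
    Runs B countStep s countStep.bound (fun s' =>
      s'.wreg 6 = i ∧ CountInv n k H x y pr X Y m s' ∧ s'.wreg 5 = m ∧
        ∀ i' < i + 1, s'.warr 2 ((m + 1) * (8 * 2 ^ H) + i') =
          below (rowRank n pr) 0 (m + 1) i') := by
  have hN : 0 < 2 ^ H := by positivity
  have hMM : 2 * ((8 * 2 ^ H) * (8 * 2 ^ H)) ≤ (H + 2) * (8 * 2 ^ H) * (8 * 2 ^ H) := by
    rw [mul_assoc (H + 2)]; exact Nat.mul_le_mul_right _ (by omega)
  have hM1 : 8 * 2 ^ H ≤ (8 * 2 ^ H) * (8 * 2 ^ H) := Nat.le_mul_of_pos_right _ (by omega)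
  have hmM : (m + 1) * (8 * 2 ^ H) ≤ (8 * 2 ^ H) * (8 * 2 ^ H) :=
    Nat.mul_le_mul_right _ (by omega)
  have hmM' : (m + 1) * (8 * 2 ^ H) = m * (8 * 2 ^ H) + 8 * 2 ^ H := by ring
  have hold := hs.count_eq m le_rfl i hi
  have hble := below_le (rowRank n pr) 0 m i
  have hsucc := below_succ (rowRank n pr) m i
  have post : ∀ v, v = below (rowRank n pr) 0 (m + 1) i →
      (s.putW 2 ((m + 1) * (8 * 2 ^ H) + i) v).wreg 6 = i ∧
      CountInv n k H x y pr X Y m (s.putW 2 ((m + 1) * (8 * 2 ^ H) + i) v) ∧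
      (s.putW 2 ((m + 1) * (8 * 2 ^ H) + i) v).wreg 5 = m ∧
      ∀ i' < i + 1, (s.putW 2 ((m + 1) * (8 * 2 ^ H) + i) v).warr 2
        ((m + 1) * (8 * 2 ^ H) + i') = below (rowRank n pr) 0 (m + 1) i' := by
    intro v hv
    refine ⟨h6, ⟨hs.base.congr (fun _ _ => rfl) (by simp) (fun _ _ => rfl) (by simp),
      by simp [hs.pr_eq], hs.X_eq, hs.Y_eq, ?_⟩, h5, ?_⟩
    · intro j hj i' hi'
      have hjm : j * (8 * 2 ^ H) ≤ m * (8 * 2 ^ H) := Nat.mul_le_mul_right _ hj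
      simp only [State.putW_warr, ↓reduceIte]
      rw [Function.update_of_ne (by omega)]
      exact hs.count_eq j hj i' hi'
    · intro i' hi'
      simp only [State.putW_warr, ↓reduceIte]
      by_cases hii : i' = i
      · rw [hii, Function.update_self, hv]
      · rw [Function.update_of_ne (by omega)]
        exact hrow i' (by omega)
  apply Runs.of_wp
  simp only [countStep, oldCount, newIndex, Prog.wp, Test.Ok, Test.Holds, WExpr.Ok, WExpr.val, h5,
    h6, hs.base.n_eq, hs.base.M_eq, hs.pr_eq, hold, true_and, ← rowRank_lt_iff hi]
  refine ⟨fun h => ⟨?_, post _ ?_⟩, fun h => ⟨?_, post _ ?_⟩⟩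
  · omega
  · rw [hsucc, if_pos h]
  · omega
  · rw [hsucc, if_neg h, add_zero]

theorem countPoints_runs : ∃ K, ∀ (n k H B : ℕ) (x y : ℕ → ℝ) (pr : ℕ → ℕ) (X Y : ℕ → ℝ)
    (s : State), (H + 2) * (8 * 2 ^ H) * (8 * 2 ^ H) < B → n ≤ 2 ^ H → n + 1 < B →
    CountInv n k H x y pr X Y 0 s →
    Runs B countPoints s (K * ((2 ^ H + 1) * (n + 2))) (CountInv n k H x y pr X Y (2 ^ H)) := by
  refine ⟨100 + countStep.bound, fun n k H B x y pr X Y s hB hn hnB hs => ?_⟩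
  have hN : 0 < 2 ^ H := by positivity
  have hNB : 2 ^ H < B := by
    refine lt_of_le_of_lt ?_ hB
    calc 2 ^ H ≤ 1 * (8 * 2 ^ H) * 1 := by omega
      _ ≤ _ := Nat.mul_le_mul (Nat.mul_le_mul_right _ (by omega)) (by omega)
  refine Runs.mono (Runs.for (I := CountInv n k H x y pr X Y) (c := 2 ^ H)
    (T := forTime (.add (.reg 0) (.lit 1)) (n + 1) countStep.bound) (by omega) hNB ?_ ?_ ?_ hs) ?_
    fun _ h => h
  · intro m s hs
    exact ⟨trivial, hs.base.N_eq⟩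
  · intro m s v hs
    exact hs.setW le_rfl v
  · intro m hm s hs h5
    refine (Runs.for (I := fun i s => CountInv n k H x y pr X Y m s ∧ s.wreg 5 = m ∧
      ∀ i' < i, s.warr 2 ((m + 1) * (8 * 2 ^ H) + i') = below (rowRank n pr) 0 (m + 1) i')
      (c := n + 1) (by omega) (by omega) ?_ ?_ ?_
      ⟨hs, h5, fun i' hi' => absurd hi' (Nat.not_lt_zero _)⟩).mono le_rfl ?_
    · rintro i s ⟨h1, -⟩
      simp only [WExpr.Ok, WExpr.val, h1.base.n_eq, true_and, and_true]
      omega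
    · rintro i s v ⟨h1, h2, h3⟩
      exact ⟨h1.setW (by norm_num) v, by simp [h2], h3⟩
    · rintro i hi s ⟨h1, h2, h3⟩ h6
      exact countStep_runs hB hn hm (by omega) h1 h3 h2 h6
    · rintro s ⟨h1, h2, h3⟩
      refine ⟨by simp [h2], h1.base, h1.pr_eq, h1.X_eq, h1.Y_eq, fun j hj i hi => ?_⟩
      rcases Nat.lt_succ_iff_lt_or_eq.mp (Nat.lt_succ_of_le hj) with hj | rfl
      · exact h1.count_eq j (by omega) i hi
      · exact h3 i (by omega)
  · simp only [forTime, WExpr.cost]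
    nlinarith

theorem CountInv.env {n k H : ℕ} {x y : ℕ → ℝ} {pr : ℕ → ℕ} {X Y : ℕ → ℝ} {s : State}
    (h : CountInv n k H x y pr X Y (2 ^ H) s) : Env n k H (rowRank n pr) X Y s :=
  ⟨h.base.n_eq, h.base.k_eq, h.base.N_eq, h.base.H_eq, h.base.M_eq, h.base.pow_eq, h.count_eq,
    h.X_eq, h.Y_eq⟩

/-- Start with the bounding box of all points as the best rectangle, and prepare for entering
intervals into the top level of the table. -/
def prepare : Prog :=
  .seq (.setR 0 (.get 2 (.lit 0))) <| .seq (.setR 1 (.get 2 (.sub (.reg 0) (.lit 1)))) <|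
  .seq (.setR 2 (.get 3 (.lit 0))) <| .seq (.setR 3 (.get 3 (.sub (.reg 0) (.lit 1)))) <|
  .seq (.setW 10 (.lit 0)) <| .seq (.setW 11 (.lit 0)) <|
  .seq (.setW 14 (.reg 2)) (.setW 15 (.lit 0))

/-- Enter the interval from register `5` to register `6` into the top level, which has the single
block `0`. -/
def pushRootStep : Prog :=
  .seq (.seq (.setW 12 (.reg 5)) (.setW 13 (.add (.reg 6) (.lit 1)))) push

/-- Enter all intervals of `x`-ranks into the top level of the table. -/
def pushRoot : Prog := .for 5 (.reg 0) (.for 6 (.reg 0) pushRootStep)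

/-- What `pushRoot` preserves. -/
structure RootInv (π : ℕ → ℕ) (X Y : ℕ → ℝ) (n k H : ℕ) (s : State) : Prop where
  env : Env n k H π X Y s
  sound : Sound π n k H (s.warr 3) (s.warr 4)
  best : HoldsRect π X Y n k s
  a_eq : s.wreg 10 = 0
  b_eq : s.wreg 11 = 0
  m_eq : s.wreg 14 = 2 ^ (H - 0)
  g_eq : s.wreg 15 = 0

section
variable {π : ℕ → ℕ} {X Y : ℕ → ℝ} {n k H B : ℕ}

theorem RootInv.setW {s : State} (h : RootInv π X Y n k H s) {c : ℕ}
    (hc : c = 5 ∨ c = 6 ∨ c = 12 ∨ c = 13) (v : ℕ) : RootInv π X Y n k H (s.setW c v) := by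
  refine ⟨h.env.congr (fun x hx => ?_) (fun _ _ => rfl) rfl, h.sound, h.best, ?_, ?_, ?_, ?_⟩
  all_goals rw [State.setW_wreg, if_neg (by omega)]
  exacts [h.a_eq, h.b_eq, h.m_eq, h.g_eq]

theorem prepare_runs {s : State} (hB : n < B) (hk : 1 ≤ k) (hkn : k ≤ n)
    (hπ : ∀ y < n, π y < n) (hs : Env n k H π X Y s) (h4 : s.warr 4 = fun _ => 0) :
    Runs B prepare s prepare.bound (RootInv π X Y n k H) := by
  apply Runs.of_wp
  simp only [prepare, Prog.wp, WExpr.Ok, WExpr.val, RExpr.Ok, RExpr.val, State.setR_wreg,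
    State.setR_rarr, hs.n_eq, hs.X_eq, hs.Y_eq, true_and, State.setW_wreg,
    Nat.reduceEqDiff, ↓reduceIte, hs.N_eq]
  refine ⟨by omega, ⟨by omega, by omega⟩, by omega, ⟨by omega, by omega⟩, by omega, by omega,
    by omega, hs.congr (fun x hx => ?_) (fun _ _ => rfl) rfl, fun z hz => ?_, ?_, ?_, ?_, ?_, ?_⟩
  · simp only [State.setW_wreg, State.setR_wreg]
    rw [if_neg (by omega), if_neg (by omega), if_neg (by omega), if_neg (by omega)]
  · exact absurd (congrFun h4 z) hz
  · refine ⟨0, n - 1, 0, n, by omega, by omega, by omega, le_rfl, ?_, by simp, by simp, by simp,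
      by simp⟩
    rw [cnt, Finset.filter_true_of_mem]
    · simp; omega
    · intro y hy
      exact ⟨Nat.zero_le _, hπ y (by simp at hy; omega)⟩
  all_goals simp

theorem pushRoot_runs : ∃ K, ∀ (π : ℕ → ℕ) (X Y : ℕ → ℝ) (n k H B : ℕ) (s : State),
    (H + 2) * (8 * 2 ^ H) * (8 * 2 ^ H) < B → 1 ≤ k → n ≤ 2 ^ H → k ≤ n → n + 1 < B →
    RootInv π X Y n k H s →
    Runs B pushRoot s (K * ((n + 1) * (n + 1))) (fun s' => RootInv π X Y n k H s' ∧
      ∀ l < n, ∀ r < n, Covered π X k H (s'.warr 3) (s'.warr 4) 0 0 0 l (r + 1)) := by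
  refine ⟨100 + pushRootStep.bound, fun π X Y n k H B s hB hk hn hkn hnB hs => ?_⟩
  refine Runs.mono (Runs.for (c := n) (T := forTime (.reg 0) n pushRootStep.bound)
    (I := fun l₀ s => RootInv π X Y n k H s ∧
      ∀ l < l₀, ∀ r < n, Covered π X k H (s.warr 3) (s.warr 4) 0 0 0 l (r + 1))
    (by omega) (by omega) ?_ ?_ ?_ ⟨hs, fun l hl => absurd hl (Nat.not_lt_zero _)⟩) ?_ fun _ h => h
  · rintro l s ⟨h, -⟩
    exact ⟨trivial, h.env.n_eq⟩
  · rintro l s v ⟨h, h'⟩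
    exact ⟨h.setW (by norm_num) v, h'⟩
  · rintro l₀ hl₀ s ⟨h, h'⟩ h5
    refine Runs.mono (Runs.for (c := n)
      (I := fun r₀ s => RootInv π X Y n k H s ∧ s.wreg 5 = l₀ ∧
        (∀ l < l₀, ∀ r < n, Covered π X k H (s.warr 3) (s.warr 4) 0 0 0 l (r + 1)) ∧
        ∀ r < r₀, Covered π X k H (s.warr 3) (s.warr 4) 0 0 0 l₀ (r + 1))
      (by omega) (by omega) ?_ ?_ ?_ ⟨h, h5, h', fun r hr => absurd hr (Nat.not_lt_zero _)⟩)
      le_rfl ?_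
    · rintro r s ⟨h, -⟩
      exact ⟨trivial, h.env.n_eq⟩
    · rintro r s v ⟨h, h5, h'⟩
      exact ⟨h.setW (by norm_num) v, by simp [h5], h'⟩
    · rintro r₀ hr₀ s ⟨h, h5, h1, h2⟩ h6
      refine Runs.seq (R := fun s' => s' = (s.setW 12 l₀).setW 13 (r₀ + 1)) (Runs.of_wp ?_) ?_
      · simp only [Prog.wp, WExpr.Ok, WExpr.val, State.setW_wreg, h5, h6, true_and,
          Nat.reduceEqDiff, ↓reduceIte, and_true]
        omega
      · rintro _ rfl
        have h' := (h.setW (c := 12) (by norm_num) l₀).setW (c := 13) (by norm_num) (r₀ + 1)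
        refine (push_runs hB hk hn hkn h'.env h'.sound (Nat.zero_le H) (by simp) (by simp)
          hl₀.le hr₀ h'.a_eq h'.b_eq (by simp) (by simp) h'.m_eq h'.g_eq).mono le_rfl ?_
        intro s' p
        have pimp : Improves X (s.warr 3) (s.warr 4) (s'.warr 3) (s'.warr 4) := p.improves
        have pw : ∀ x < 12, s'.wreg x = s.wreg x := by
          intro x hx
          rw [p.wreg_eq x (by omega), State.setW_wreg, State.setW_wreg, if_neg (by omega),
            if_neg (by omega)]
        refine ⟨by rw [pw _ (by norm_num), h6], ⟨h'.env.congr (fun x hx => p.wreg_eq x (by omega))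
          p.warr_eq p.rarr_eq, p.sound, h'.best.congr p.rreg_eq,
          by rw [pw _ (by norm_num), h.a_eq], by rw [pw _ (by norm_num), h.b_eq],
          by rw [p.wreg_eq _ (by norm_num), h'.m_eq], by rw [p.wreg_eq _ (by norm_num), h'.g_eq]⟩,
          by rw [pw _ (by norm_num), h5], fun l hl r hr => (h1 l hl r hr).of_improves pimp,
          fun r hr => ?_⟩
        rcases Nat.lt_succ_iff_lt_or_eq.mp hr with hr | rfl
        · exact (h2 r hr).of_improves pimp
        · exact p.covered
    · rintro s ⟨h, h5, h1, h2⟩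
      refine ⟨h5, h, fun l hl r hr => ?_⟩
      rcases Nat.lt_succ_iff_lt_or_eq.mp hl with hl | rfl
      · exact h1 l hl r hr
      · exact h2 r hr
  · simp only [forTime, WExpr.cost]
    nlinarith

end

/-- `X`, `Y` list the coordinates of the points `(x i, y i)`, `i < n`, in order, and `pr` lists
the `x`-ranks in the order of the `y`-ranks. -/
def Ranked (n : ℕ) (x y : ℕ → ℝ) (pr : ℕ → ℕ) (X Y : ℕ → ℝ) : Prop :=
  ∀ i < n, X (rankUpTo x n i) = x i ∧ Y (rankUpTo y n i) = y i ∧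
    pr (rankUpTo y n i) = rankUpTo x n i

/-- The program that computes a smallest rectangle, for the score computed by `F`. -/
def program (F : RExpr → RExpr → RExpr) : Prog :=
  .seq powers <| .seq sortPoints <| .seq countPoints <| .seq prepare <| .seq pushRoot <|
    .for 5 tableSize (processEntry F)

/-- The program, started with the points `(x i, y i)` for `i < n`, ends with a full table whose
entries have all been dealt with, after `O(N² log N)` steps, where `N = 2 ^ clog 2 n`. -/
theorem program_runs {F : RExpr → RExpr → RExpr} {sc : ℝ → ℝ → ℝ} (hF : Computes F sc) :
    ∃ K, ∀ (n k B : ℕ) (s : State) (x y : ℕ → ℝ), 1 ≤ k → k ≤ n →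
      (Nat.clog 2 n + 2) * (8 * 2 ^ Nat.clog 2 n) * (8 * 2 ^ Nat.clog 2 n) < B →
      s.wreg 0 = n → s.wreg 1 = k → s.wreg 3 = 0 → s.rarr 0 = x → s.rarr 1 = y →
      s.warr 2 = (fun _ => 0) → s.warr 4 = (fun _ => 0) →
      Runs B (program F) s (K * ((Nat.clog 2 n + 1) * (2 ^ Nat.clog 2 n * 2 ^ Nat.clog 2 n)))
        (fun s' => ∃ (pr : ℕ → ℕ) (X Y : ℕ → ℝ),
          Ranked n x y pr X Y ∧
          LoopInv (rowRank n pr) X Y n k (Nat.clog 2 n) sc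
            ((Nat.clog 2 n + 1) * (8 * 2 ^ Nat.clog 2 n) * (8 * 2 ^ Nat.clog 2 n)) s') := by
  obtain ⟨K1, h1⟩ := powers_runs
  obtain ⟨K2, h2⟩ := sortPoints_runs
  obtain ⟨K3, h3⟩ := countPoints_runs
  obtain ⟨K4, h4⟩ := pushRoot_runs
  refine ⟨K1 + 4 * K2 + 6 * K3 + prepare.bound + 4 * K4 +
    128 * ((processEntry F).bound + 15), fun n k B s x y hk hkn hB i0 i1 i3 ix iy iw2 iw4 => ?_⟩
  have hnN : n ≤ 2 ^ Nat.clog 2 n := Nat.le_pow_clog (by norm_num) n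
  set H := Nat.clog 2 n with hH
  have hN : 0 < 2 ^ H := by positivity
  have hMB : 16 * 2 ^ H < B := by
    refine lt_of_le_of_lt ?_ hB
    calc 16 * 2 ^ H = 2 * (8 * 2 ^ H) * 1 := by ring
      _ ≤ _ := Nat.mul_le_mul (Nat.mul_le_mul_right _ (by omega)) (by omega)
  have hHB : H < B := by
    refine lt_of_le_of_lt ?_ hB
    calc H ≤ (H + 2) * 1 * 1 := by omega
      _ ≤ _ := Nat.mul_le_mul (Nat.mul_le_mul_left _ (by omega)) (by omega)
  refine Runs.mono (T := K1 * (H + 1) + (K2 * ((n + 1) * (n + 1)) +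
      (K3 * ((2 ^ H + 1) * (n + 2)) + (prepare.bound + (K4 * ((n + 1) * (n + 1)) +
        forTime tableSize ((H + 1) * (8 * 2 ^ H) * (8 * 2 ^ H)) (processEntry F).bound)))))
   
    ((h1 n k B s x y (show 8 * 2 ^ H < B by omega) hHB i0 i1 i3 ix iy iw2 iw4).seq fun s1 p1 =>
      (h2 n k H B s1 x y (by omega) p1.1 p1.2).seq
        (Q := fun s' => ∃ (pr : ℕ → ℕ) (X Y : ℕ → ℝ),
          Ranked n x y pr X Y ∧
          LoopInv (rowRank n pr) X Y n k H sc ((H + 1) * (8 * 2 ^ H) * (8 * 2 ^ H)) s')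
        fun s2 p2 => ?_) ?_ fun _ h => h
  · obtain ⟨base, hw2, hsorted⟩ := p2
    have hpr : ∀ y < n, rowRank n (s2.warr 0) y < n := by
      intro r hr
      rw [rowRank_lt_iff le_rfl]
      refine ⟨hr, ?_⟩
      obtain ⟨i, hi, rfl⟩ := exists_rankUpTo_eq (x := y) hr
      rw [(hsorted i hi).2.2]
      exact rankUpTo_lt hi
    refine (h3 n k H B x y _ _ _ s2 hB hnN (by omega) ⟨base, rfl, rfl, rfl, ?_⟩).seq fun s3 p3 =>
      (prepare_runs (by omega) hk hkn hpr p3.env p3.base.table_eq).seq fun s4 p4 =>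
      (h4 _ _ _ n k H B s4 hB hk hnN hkn (by omega) p4).seq fun s5 p5 =>
      (processAll_runs hF hB hk hnN hkn ⟨p5.1.env, p5.1.sound, p5.2,
        fun z hz => absurd hz (Nat.not_lt_zero _), fun z hz => absurd hz (Nat.not_lt_zero _),
        p5.1.best⟩).mono le_rfl fun s6 p6 => ⟨_, _, _, hsorted, p6⟩
    intro j hj i _
    obtain rfl : j = 0 := by omega
    simp [hw2, below]
  · have e1 : H + 1 ≤ (H + 1) * (2 ^ H * 2 ^ H) := Nat.le_mul_of_pos_right _ (by positivity)
    have e2 : 2 ^ H * 2 ^ H ≤ (H + 1) * (2 ^ H * 2 ^ H) := Nat.le_mul_of_pos_left _ (by omega)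
    have e3 : (n + 1) * (n + 1) ≤ 4 * ((H + 1) * (2 ^ H * 2 ^ H)) := by
      calc (n + 1) * (n + 1) ≤ (2 * 2 ^ H) * (2 * 2 ^ H) := Nat.mul_le_mul (by omega) (by omega)
        _ = 4 * (2 ^ H * 2 ^ H) := by ring
        _ ≤ _ := Nat.mul_le_mul_left _ e2
    have e4 : (2 ^ H + 1) * (n + 2) ≤ 6 * ((H + 1) * (2 ^ H * 2 ^ H)) := by
      calc (2 ^ H + 1) * (n + 2) ≤ (2 * 2 ^ H) * (3 * 2 ^ H) :=
            Nat.mul_le_mul (by omega) (by omega)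
        _ = 6 * (2 ^ H * 2 ^ H) := by ring
        _ ≤ _ := Nat.mul_le_mul_left _ e2
    have e5 : forTime tableSize ((H + 1) * (8 * 2 ^ H) * (8 * 2 ^ H)) (processEntry F).bound ≤
        128 * ((processEntry F).bound + 15) * ((H + 1) * (2 ^ H * 2 ^ H)) := by
      have : (H + 1) * (8 * 2 ^ H) * (8 * 2 ^ H) + 1 ≤ 128 * ((H + 1) * (2 ^ H * 2 ^ H)) := by
        have : (H + 1) * (8 * 2 ^ H) * (8 * 2 ^ H) = 64 * ((H + 1) * (2 ^ H * 2 ^ H)) := by ring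
        omega
      calc forTime tableSize ((H + 1) * (8 * 2 ^ H) * (8 * 2 ^ H)) (processEntry F).bound
          ≤ 128 * ((H + 1) * (2 ^ H * 2 ^ H)) * ((processEntry F).bound + 15) := by
            simp only [forTime, tableSize, WExpr.cost]
            exact Nat.mul_le_mul this (by omega)
        _ = _ := by ring
    have e6 : prepare.bound ≤ prepare.bound * ((H + 1) * (2 ^ H * 2 ^ H)) :=
      Nat.le_mul_of_pos_right _ (by positivity)
    generalize (H + 1) * (2 ^ H * 2 ^ H) = Z at *
    have f1 := Nat.mul_le_mul_left K1 e1
    have f2 := Nat.mul_le_mul_left K2 e3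
    have f3 := Nat.mul_le_mul_left K3 e4
    have f4 := Nat.mul_le_mul_left K4 e3
    linarith

end EnclosingRect

/-! ### Correctness and running time -/

namespace EnclosingRect
open RealRAM

theorem cnt_le_cnt_succ_add_one {π : ℕ → ℕ} {n y₁ y₂ l r : ℕ}
    (hπ : ∀ y < n, ∀ y' < n, π y = π y' → y = y') (hy : y₂ ≤ n) :
    cnt π y₁ y₂ l r ≤ cnt π y₁ y₂ (l + 1) r + 1 := by
  have hone : ((Finset.Ico y₁ y₂).filter fun y => π y = l).card ≤ 1 := by
    rw [Finset.card_le_one]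
    intro a ha b hb
    simp only [Finset.mem_filter, Finset.mem_Ico] at ha hb
    exact hπ a (by omega) b (by omega) (ha.2.trans hb.2.symm)
  refine le_trans ?_ (Nat.add_le_add_left hone _)
  refine le_trans (Finset.card_le_card ?_) (Finset.card_union_le _ _)
  intro y
  simp only [Finset.mem_union, Finset.mem_filter]
  rintro ⟨h1, h2, h3⟩
  by_cases h : π y = l
  · exact .inr ⟨h1, h⟩
  · exact .inl ⟨h1, by omega, h3⟩

/-- An interval with at least `k` points can be shrunk from the left to one with exactly `k`. -/
theorem exists_cnt_eq {π : ℕ → ℕ} {n y₁ y₂ k r : ℕ}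
    (hπ : ∀ y < n, ∀ y' < n, π y = π y' → y = y') (hy : y₂ ≤ n) {l : ℕ} (hl : l ≤ r)
    (h : k ≤ cnt π y₁ y₂ l r) : ∃ l', l ≤ l' ∧ cnt π y₁ y₂ l' r = k := by
  induction hl using Nat.decreasingInduction with
  | self => exact ⟨r, le_rfl, by rw [cnt_eq_zero π _ _ le_rfl] at h ⊢; omega⟩
  | of_succ l hl ih =>
    rcases h.eq_or_lt with h' | h'
    · exact ⟨l, le_rfl, h'.symm⟩
    · have := cnt_le_cnt_succ_add_one (l := l) (r := r) (y₁ := y₁) hπ hy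
      obtain ⟨l', h1, h2⟩ := ih (by omega)
      exact ⟨l', by omega, h2⟩

section
variable {n : ℕ} {x y : ℕ → ℝ} {pr : ℕ → ℕ} {X Y : ℕ → ℝ}

theorem sorted_mono (h : ∀ i < n, X (rankUpTo x n i) = x i) {l r : ℕ} (hlr : l ≤ r) (hr : r < n) :
    X l ≤ X r := by
  obtain ⟨i, hi, rfl⟩ := exists_rankUpTo_eq (x := x) (hlr.trans_lt hr)
  obtain ⟨j, hj, rfl⟩ := exists_rankUpTo_eq (x := x) hr
  rw [h i hi, h j hj]
  exact le_of_rankUpTo_le hj hlr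

theorem Ranked.rowRank_eq (h : Ranked n x y pr X Y) {i : ℕ} (hi : i < n) :
    rowRank n pr (rankUpTo y n i) = rankUpTo x n i := by
  rw [rowRank, if_pos (rankUpTo_lt hi), (h i hi).2.2]

theorem Ranked.rowRank_inj (h : Ranked n x y pr X Y) :
    ∀ r < n, ∀ r' < n, rowRank n pr r = rowRank n pr r' → r = r' := by
  intro r hr r' hr' heq
  obtain ⟨i, hi, rfl⟩ := exists_rankUpTo_eq (x := y) hr
  obtain ⟨j, hj, rfl⟩ := exists_rankUpTo_eq (x := y) hr'
  rw [h.rowRank_eq hi, h.rowRank_eq hj] at heq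
  rw [rankUpTo_inj hi hj heq]

/-- Counting rows is counting points. -/
theorem Ranked.cnt_eq_card (h : Ranked n x y pr X Y) {y₁ y₂ l r : ℕ} (hy : y₂ ≤ n) :
    cnt (rowRank n pr) y₁ y₂ l r = (Finset.univ.filter fun i : Fin n =>
      (y₁ ≤ rankUpTo y n i ∧ rankUpTo y n i < y₂) ∧
        l ≤ rankUpTo x n i ∧ rankUpTo x n i < r).card := by
  symm
  unfold cnt
  apply Finset.card_bij (fun (i : Fin n) _ => rankUpTo y n i)
  · intro i hi
    simp only [Finset.mem_filter, Finset.mem_univ, true_and] at hi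
    simp only [Finset.mem_filter, Finset.mem_Ico, h.rowRank_eq i.2]
    exact hi
  · intro i _ j _ hij
    exact Fin.ext (rankUpTo_inj i.2 j.2 hij)
  · intro r' hr'
    simp only [Finset.mem_filter, Finset.mem_Ico] at hr'
    obtain ⟨i, hi, rfl⟩ := exists_rankUpTo_eq (x := y) (show r' < n by omega)
    rw [h.rowRank_eq hi] at hr'
    exact ⟨⟨i, hi⟩, by simpa using hr', rfl⟩

end

section
variable {n k : ℕ} {p : Fin n → ℝ × ℝ} {x y : ℕ → ℝ} {pr : ℕ → ℕ} {X Y : ℕ → ℝ}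

theorem encloses_of_le_cnt (hp : Function.Injective p) (hx : ∀ i : Fin n, x i = (p i).1)
    (hy : ∀ i : Fin n, y i = (p i).2) (h : Ranked n x y pr X Y) {a b l r : ℕ} (hb : b < n)
    (hr : r ≤ n) (hk : k ≤ cnt (rowRank n pr) a (b + 1) l r) {R : Rect} (h0 : R.left = X l)
    (h1 : R.right = X (r - 1)) (h2 : R.bottom = Y a) (h3 : R.top = Y b) :
    R.Encloses (Set.range p) k := by
  classical
  rw [h.cnt_eq_card (by omega)] at hk
  obtain ⟨I, hI, rfl⟩ := Finset.exists_subset_card_eq hk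
  refine ⟨I.image p, ?_, Finset.card_image_of_injective _ hp⟩
  intro q hq
  simp only [Finset.coe_image, Set.mem_image, Finset.mem_coe] at hq
  obtain ⟨i, hi, rfl⟩ := hq
  have hi' := hI hi
  simp only [Finset.mem_filter, Finset.mem_univ, true_and] at hi'
  obtain ⟨⟨e1, e2⟩, e3, e4⟩ := hi'
  have hX := fun i hi => (h i hi).1
  have hY := fun i hi => (h i hi).2.1
  refine ⟨⟨i, rfl⟩, ⟨?_, ?_⟩, ?_, ?_⟩
  · rw [h0, ← hx, ← hX i i.2]
    exact sorted_mono hX e3 (rankUpTo_lt i.2)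
  · rw [h1, ← hx, ← hX i i.2]
    exact sorted_mono hX (by omega) (by omega)
  · rw [h2, ← hy, ← hY i i.2]
    exact sorted_mono hY e1 (rankUpTo_lt i.2)
  · rw [h3, ← hy, ← hY i i.2]
    exact sorted_mono hY (by omega) hb

/-- For every rectangle with `k` points there is a range of rows and an interval of `x`-ranks with
exactly `k` points that is not larger in either direction. -/
theorem exists_interval_of_encloses (hp : Function.Injective p)
    (hx : ∀ i : Fin n, x i = (p i).1) (hy : ∀ i : Fin n, y i = (p i).2)
    (h : Ranked n x y pr X Y) (hk : 1 ≤ k) {R : Rect} (hR : R.Encloses (Set.range p) k) :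
    ∃ a b l r, a ≤ b ∧ b < n ∧ r ≤ n ∧ cnt (rowRank n pr) a (b + 1) l r = k ∧
      width X l r ≤ R.right - R.left ∧ Y b - Y a ≤ R.top - R.bottom := by
  classical
  obtain ⟨Q, hQ, hcard⟩ := hR
  set I := Finset.univ.filter fun i : Fin n => p i ∈ Q with hI
  have hmem : ∀ i, i ∈ I ↔ p i ∈ Q := by simp [hI]
  have himage : I.image p = Q := by
    ext q
    simp only [Finset.mem_image, hmem]
    constructor
    · rintro ⟨i, hi, rfl⟩
      exact hi
    · intro hq
      obtain ⟨i, rfl⟩ := (hQ hq).1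
      exact ⟨i, hq, rfl⟩
  have hIcard : I.card = k := by
    rw [← hcard, ← himage, Finset.card_image_of_injective _ hp]
  have hne : I.Nonempty := by
    rw [← Finset.card_pos]; omega
  obtain ⟨i₁, hi₁, hmin⟩ := I.exists_min_image (fun i => rankUpTo y n i) hne
  obtain ⟨i₂, hi₂, hmax⟩ := I.exists_max_image (fun i => rankUpTo y n i) hne
  obtain ⟨j₁, hj₁, hmin'⟩ := I.exists_min_image (fun i => rankUpTo x n i) hne
  obtain ⟨j₂, hj₂, hmax'⟩ := I.exists_max_image (fun i => rankUpTo x n i) hne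
  have hrect : ∀ i ∈ I, (R.left ≤ x i ∧ x i ≤ R.right) ∧ R.bottom ≤ y i ∧ y i ≤ R.top := by
    intro i hi
    rw [hx, hy]
    exact (hQ ((hmem i).1 hi)).2
  have hle : k ≤ cnt (rowRank n pr) (rankUpTo y n i₁) (rankUpTo y n i₂ + 1) (rankUpTo x n j₁)
      (rankUpTo x n j₂ + 1) := by
    rw [h.cnt_eq_card (rankUpTo_lt i₂.2), ← hIcard]
    apply Finset.card_le_card
    intro i hi
    simp only [Finset.mem_filter, Finset.mem_univ, true_and]
    exact ⟨⟨hmin i hi, Nat.lt_succ_of_le (hmax i hi)⟩, hmin' i hi, Nat.lt_succ_of_le (hmax' i hi)⟩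
  obtain ⟨l, hl, hc⟩ := exists_cnt_eq h.rowRank_inj (rankUpTo_lt i₂.2)
    ((hmin' j₂ hj₂).trans (Nat.le_succ _)) hle
  have hlt : l < rankUpTo x n j₂ + 1 := lt_of_cnt_pos (π := rowRank n pr) (by rw [hc]; omega)
  -- rows and right end are those of the bounding box of the `k` points; the left end has moved
  -- inwards if the bounding box contains more than `k` points
  refine ⟨_, _, l, _, hmin i₂ hi₂, rankUpTo_lt i₂.2, rankUpTo_lt j₂.2, hc, ?_, ?_⟩
  · have e1 := sorted_mono (fun i hi => (h i hi).1) hl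
      (lt_of_le_of_lt (Nat.le_of_lt_succ hlt) (rankUpTo_lt j₂.2))
    rw [(h j₁ j₁.2).1] at e1
    rw [width, Nat.succ_sub_one, (h j₂ j₂.2).1]
    have := hrect j₁ hj₁
    have := hrect j₂ hj₂
    linarith
  · rw [(h i₁ i₁.2).2.1, (h i₂ i₂.2).2.1]
    have := hrect i₁ hi₁
    have := hrect i₂ hi₂
    linarith

/-- When all table entries have been dealt with, the output is a smallest rectangle. -/
theorem exists_smallest {H : ℕ} {sc : ℝ → ℝ → ℝ} {score : Rect → ℝ} {s : State}
    (hscore : ∀ R : Rect, score R = sc (R.right - R.left) (R.top - R.bottom))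
    (hsc : ∀ w w' h h', 0 ≤ w → w ≤ w' → 0 ≤ h → h ≤ h' → sc w h ≤ sc w' h')
    (hp : Function.Injective p) (hx : ∀ i : Fin n, x i = (p i).1)
    (hy : ∀ i : Fin n, y i = (p i).2) (h : Ranked n x y pr X Y) (hk : 1 ≤ k) (hn : n ≤ 2 ^ H)
    (hs : LoopInv (rowRank n pr) X Y n k H sc ((H + 1) * (8 * 2 ^ H) * (8 * 2 ^ H)) s) :
    ∃ R : Rect, OutputsRect s R ∧ R.IsSmallest score (Set.range p) k := by
  have hX := fun i hi => (h i hi).1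
  have hY := fun i hi => (h i hi).2.1
  obtain ⟨a, b, l, r, hab, hb, hlr, hr, hc, e0, e1, e2, e3⟩ := hs.best
  refine ⟨⟨s.rreg 0, s.rreg 1, s.rreg 2, s.rreg 3, ?_, ?_⟩, ⟨rfl, rfl, rfl, rfl⟩, ?_, ?_⟩
  · rw [e0, e1]
    exact sorted_mono hX (by omega) (by omega)
  · rw [e2, e3]
    exact sorted_mono hY hab hb
  · exact encloses_of_le_cnt hp hx hy h hb hr hc e0 e1 e2 e3
  · intro R' hR'
    obtain ⟨y₁, y₂, l₀, r₀, hyy, hy₂, hr₀, hc₀, hw, hh⟩ :=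
      exists_interval_of_encloses hp hx hy h hk hR'
    have entry : ∀ z, s.warr 4 z ≠ 0 → z < (H + 1) * (8 * 2 ^ H) * (8 * 2 ^ H) := by
      intro z hz
      obtain ⟨g, a, b, hg, ha, hb, -, -, hv, hz'⟩ := hs.sound z hz
      have hlt := key_lt hg ha hb hv
      rw [← hz'] at hlt
      exact hlt.trans_le (Nat.mul_le_mul_right _ (Nat.mul_le_mul_right _ (by omega)))
    obtain ⟨z, hz, hv, hkey, hcz, hwz⟩ := exists_entry hk hs.sound hs.root
      (fun z hz => hs.children z (entry z hz) hz) hyy (hy₂.trans_le hn) hr₀ hc₀ H le_rfl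
    simp only [Nat.sub_self, pow_zero, Nat.div_one] at hv hkey
    have hleaf := hs.leaf z (entry z hz) hz y₁ y₂ (by omega) (by omega) hy₂
      (by simpa using hv) hkey
    have hlt : s.warr 3 z < s.warr 4 z :=
      lt_of_cnt_pos (π := rowRank n pr) (y₁ := y₁) (y₂ := y₂ + 1) (by omega)
    have hle : s.warr 4 z ≤ n := by
      obtain ⟨_, _, _, _, _, _, _, h, _⟩ := hs.sound z hz
      exact h
    rw [hscore, hscore]
    refine hleaf.trans (hsc _ _ _ _ ?_ (hwz.trans hw) ?_ hh)
    · exact sub_nonneg.2 (sorted_mono hX (by omega) (by omega))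
    · exact sub_nonneg.2 (sorted_mono hY hyy hy₂)

end

/-- `(log₂ n + 1) N² = O(n² log n)` for the power of two `N` with `n ≤ N < 2 n`. -/
theorem time_isBigO (K : ℕ) :
    (fun n : ℕ => ((K * ((Nat.clog 2 n + 1) * (2 ^ Nat.clog 2 n * 2 ^ Nat.clog 2 n)) : ℕ) : ℝ))
      =O[atTop] (fun n : ℕ => (n : ℝ) ^ 2 * Real.log (n : ℝ)) := by
  refine IsBigO.of_bound (K * (4 * (3 / Real.log 2))) ?_
  filter_upwards [eventually_ge_atTop 2] with n hn
  have hlog2 : 0 < Real.log 2 := Real.log_pos (by norm_num)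
  have hn' : (2 : ℝ) ≤ n := by exact_mod_cast hn
  have hlog : Real.log 2 ≤ Real.log n := Real.log_le_log (by norm_num) hn'
  have hpos : 0 < Nat.clog 2 n := Nat.clog_pos (by norm_num) hn
  have hpred : 2 ^ (Nat.clog 2 n - 1) < n := Nat.pow_pred_clog_lt_self (by norm_num) hn
  have hpow : 2 ^ Nat.clog 2 n = 2 * 2 ^ (Nat.clog 2 n - 1) := by
    rw [← pow_succ']; congr 1; omega
  have hN : ((2 : ℝ) ^ Nat.clog 2 n) ≤ 2 * n := by
    have : 2 ^ Nat.clog 2 n ≤ 2 * n := by omega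
    exact_mod_cast this
  have hC : (Nat.clog 2 n : ℝ) + 1 ≤ 3 / Real.log 2 * Real.log n := by
    have h1 : ((Nat.clog 2 n : ℝ) - 1) * Real.log 2 ≤ Real.log n := by
      have h2 : ((2 : ℝ) ^ (Nat.clog 2 n - 1)) ≤ n := by exact_mod_cast hpred.le
      have h3 := Real.log_le_log (by positivity) h2
      rw [Real.log_pow, Nat.cast_sub hpos] at h3
      simpa using h3
    rw [div_mul_eq_mul_div, le_div_iff₀ hlog2]
    linarith
  have hnn : 0 ≤ (n : ℝ) ^ 2 * Real.log n := by positivity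
  rw [Real.norm_of_nonneg (by positivity), Real.norm_of_nonneg hnn]
  push_cast
  calc (K : ℝ) * (((Nat.clog 2 n : ℝ) + 1) * (2 ^ Nat.clog 2 n * 2 ^ Nat.clog 2 n))
      ≤ K * ((3 / Real.log 2 * Real.log n) * ((2 * n) * (2 * n))) := by gcongr
    _ = _ := by ring

/-- The program works for every score that is a monotone function of the width and the height
and is computed by a fixed real expression in them. -/
theorem exists_program {F : RExpr → RExpr → RExpr} {sc : ℝ → ℝ → ℝ} (hF : Computes F sc)
    {score : Rect → ℝ}
    (hscore : ∀ R : Rect, score R = sc (R.right - R.left) (R.top - R.bottom))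
    (hsc : ∀ w w' h h', 0 ≤ w → w ≤ w' → 0 ≤ h → h ≤ h' → sc w h ≤ sc w' h') :
    ∃ (prog : RealRAM.Prog) (c : ℕ) (T : ℕ → ℕ),
      (fun n : ℕ => (T n : ℝ)) =O[atTop] (fun n : ℕ => (n : ℝ) ^ 2 * Real.log (n : ℝ)) ∧
      ∀ (n k : ℕ) (p : Fin n → ℝ × ℝ), Function.Injective p → 1 ≤ k → k ≤ n →
        ∃ (t : ℕ) (s : RealRAM.State) (R : Rect),
          RealRAM.Exec ((n + 2) ^ c) prog (inputState p k) t s ∧ t ≤ T n ∧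
          OutputsRect s R ∧ R.IsSmallest score (Set.range p) k := by
  obtain ⟨K, hK⟩ := program_runs hF
  -- table positions are below `(clog 2 n + 1) * (8 * 2 ^ clog 2 n) ^ 2`, which is `O(n ^ 3)`;
  -- the exponent leaves room for the constant when `n = 1`
  refine ⟨program F, 12, _, time_isBigO K, fun n k p hp hk hkn => ?_⟩
  have hB : (Nat.clog 2 n + 2) * (8 * 2 ^ Nat.clog 2 n) * (8 * 2 ^ Nat.clog 2 n)
      < (n + 2) ^ 12 := by
    have h1 : Nat.clog 2 n ≤ n := (Nat.clog_le_iff_le_pow (by norm_num)).2 n.lt_two_pow_self.le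
    have h2 : 2 ^ Nat.clog 2 n ≤ 2 * n := by
      rcases Nat.lt_or_ge n 2 with h | h
      · obtain rfl : n = 1 := by omega
        simp
      · have := Nat.pow_pred_clog_lt_self (b := 2) (by norm_num) h
        have hpos : 0 < Nat.clog 2 n := Nat.clog_pos (by norm_num) h
        have hpow : 2 ^ Nat.clog 2 n = 2 * 2 ^ (Nat.clog 2 n - 1) := by
          rw [← pow_succ']; congr 1; omega
        rw [Nat.pred_eq_sub_one] at this
        omega
    calc (Nat.clog 2 n + 2) * (8 * 2 ^ Nat.clog 2 n) * (8 * 2 ^ Nat.clog 2 n)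
        ≤ (n + 2) * (16 * (n + 2)) * (16 * (n + 2)) :=
          Nat.mul_le_mul (Nat.mul_le_mul (by omega) (by omega)) (by omega)
      _ = 256 * (n + 2) ^ 3 := by ring
      _ < (n + 2) ^ 9 * (n + 2) ^ 3 := by
          refine Nat.mul_lt_mul_of_pos_right ?_ (by positivity)
          calc 256 < 3 ^ 9 := by norm_num
            _ ≤ (n + 2) ^ 9 := Nat.pow_le_pow_left (by omega) 9
      _ = (n + 2) ^ 12 := by ring
  obtain ⟨t, s, hexec, ht, pr, X, Y, hranked, hinv⟩ := hK n k _ (inputState p k) _ _ hk hkn hB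
    rfl rfl rfl rfl rfl rfl rfl
  obtain ⟨R, hR, hR'⟩ := exists_smallest hscore hsc hp (fun i => by simp [inputState])
    (fun i => by simp [inputState]) hranked hk (Nat.le_pow_clog (by norm_num) n) hinv
  exact ⟨t, s, R, hexec, ht, hR, hR'⟩

end EnclosingRect

open EnclosingRect in
theorem mainTheorem1 (score : Rect → ℝ) (hscore : score = Rect.area ∨ score = Rect.perimeter) :
    ∃ (prog : RealRAM.Prog) (c : ℕ) (T : ℕ → ℕ),
      (fun n : ℕ => (T n : ℝ)) =O[atTop] (fun n : ℕ => (n : ℝ) ^ 2 * Real.log (n : ℝ)) ∧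
      ∀ (n k : ℕ) (p : Fin n → ℝ × ℝ), Function.Injective p → 1 ≤ k → k ≤ n →
        ∃ (t : ℕ) (s : RealRAM.State) (R : Rect),
          RealRAM.Exec ((n + 2) ^ c) prog (inputState p k) t s ∧ t ≤ T n ∧
          OutputsRect s R ∧ R.IsSmallest score (Set.range p) k := by
  rcases hscore with rfl | rfl
  · exact exists_program (F := .mul) (sc := fun w h => w * h)
      (fun _ _ _ _ h1 h2 => ⟨⟨h1, h2⟩, rfl⟩) (fun R => rfl)
      fun w w' h h' hw hww hh hhh => mul_le_mul hww hhh hh (hw.trans hww)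
  · exact exists_program (F := fun e f => .mul (.lit 2) (.add e f)) (sc := fun w h => 2 * (w + h))
      (fun _ _ _ _ h1 h2 => ⟨⟨trivial, h1, h2⟩, by simp [RealRAM.RExpr.val]⟩) (fun R => rfl)
      fun w w' h h' hw hww hh hhh => by linarith
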